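/- Let $l,N,K\ge 0$ be integers, let $R$ be a commutative $\mathbb{Q}$-algebra, let $x_1,\dots,x_N$ be invertible elements of $R$ (for instance the indeterminates of $R=\mathbb{Q}[x_1^{\pm1},\dots,x_N^{\pm1}]$), write $x^{\pm}=(x_1,x_1^{-1},\dots,x_N,x_N^{-1})$, and let $y=(y_1,\dots,y_K)$ be indeterminates. Define $h_n(x^{\pm})\in R$ and $f_n(y)\in R[[y_1,\dots,y_K]]$, for $n\in\mathbb{Z}$, by $$\prod_{i=1}^N\frac{1}{(1-x_iz)(1-x_i^{-1}z)}=\sum_{n\in\mathbb{Z}}h_n(x^{\pm})z^n,\qquad \prod_{j=1}^K\frac{1}{(1-y_jz)(1-y_jz^{-1})}=\sum_{n\in\mathbb{Z}}f_n(y)z^n,$$ the first expanded as a power series in $z$ (so $h_n=0$ for $n<0$), the second as a power series in $y_1,\dots,y_K$ with coefficients in $R[z,z^{-1}]$. A generalized partition with $n$ entries is a sequence of integers $\rho_1\ge\dots\ge\rho_n\ge 0$. For generalized partitions $\lambda=(\lambda_1,\dots,\lambda_{l+N})$ and $\mu=(\mu_1,\dots,\mu_l)$, the skew symplectic and the skew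 even orthogonal character are given by their Jacobi--Trudi determinants $sp_{\lambda/\mu}(x^{\pm})=\det(a_{ij})_{1\le i,j\le l+N}$ and $o_{\lambda/\mu}(x^{\pm})=\det(b_{ij})_{1\le i,j\le l+N}$, where $$a_{ij}=b_{ij}=h_{\lambda_i-\mu_j-i+j}(x^\pm)\quad(1\le j\le l),$$ $$a_{i,l+1}=h_{\lambda_i-i+l+1}(x^\pm),\qquad a_{ij}=h_{\lambda_i-i+j}(x^\pm)+h_{\lambda_i-i-j+2l+2}(x^\pm)\quad(l+2\le j\le l+N),$$ $$b_{ij}=h_{\lambda_i-i+j}(x^\pm)-h_{\lambda_i-i-j+2l}(x^\pm)\quad(l+1\le j\le l+N).$$ For generalized partitions $\alpha,\beta$ with the same number $m$ of entries, put $$SP^*_{\alpha/\beta}(y)=\det\bigl(f_{\beta_i-\alpha_j-i+j}(y)-f_{\beta_i+\alpha_j-i-j+2(m+1)}(y)\bigr)_{1\le i,j\le m},$$ $$O^*_{\alpha/\beta}(y)=c_\beta\det\bigl(f_{\beta_i-\alpha_j-i+j}(y)+f_{\beta_i+\alpha_j-i-j+2m}(y)\bigr)_{1\le i,j\le m},$$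 where $c_\beta=\tfrac12$ if $m\ge1$ and $\beta_m=0$, and $c_\beta=1$ otherwise. Then for all generalized partitions $\mu=(\mu_1,\dots,\mu_l)$ and $\lambda=(\lambda_1,\dots,\lambda_{l+N})$, $$\sum_{\rho=(\rho_1,\dots,\rho_{l+N})}sp_{\rho/\mu}(x^{\pm})\,SP^*_{\rho/\lambda}(y)=\prod_{i=1}^N\prod_{j=1}^K\frac{1}{(1-x_iy_j)(1-x_i^{-1}y_j)}\sum_{\tau=(\tau_1,\dots,\tau_l)}sp_{\lambda/\tau}(x^{\pm})\,SP^*_{\mu/\tau}(y),$$ $$\sum_{\rho=(\rho_1,\dots,\rho_{l+N})}o_{\rho/\mu}(x^{\pm})\,O^*_{\rho/\lambda}(y)=\prod_{i=1}^N\prod_{j=1}^K\frac{1}{(1-x_iy_j)(1-x_i^{-1}y_j)}\sum_{\tau=(\tau_1,\dots,\tau_l)}o_{\lambda/\tau}(x^{\pm})\,O^*_{\mu/\tau}(y)$$ in $R[[y_1,\dots,y_K]]$. The sums run over all generalized partitions with the indicated number of entries. On the right only finitely many $sp_{\lambda/\tau}$, respectively $o_{\lambda/\tau}$, are nonzero.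 On the left the sums converge in the topology of formal power series over the discrete ring $R$: each coefficient in $y$ receives nonzero contributions from only finitely many $\rho$. -/

import Mathlib

open scoped LaurentPolynomial MvPowerSeries.WithPiTopology

namespace SkewCauchy

/-- Generalized partitions `(ρ₁ ≥ ρ₂ ≥ ⋯ ≥ ρₙ ≥ 0)` with exactly `n` entries, zeros allowed.
The entry `ρᵢ` of the usual 1-based notation is `ρ.part` at the index `i - 1 : Fin n`. -/
structure GenPartition (n : ℕ) where
  part : Fin n → ℕ
  antitone : Antitone part

/-- The 1-based position of an index, as an integer. -/
def pos {n : ℕ} (i : Fin n) : ℤ := (i : ℕ) + 1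

section Characters

variable {R : Type*} [CommRing R] {N l : ℕ}

/-- The generating function `∏ᵢ 1 / ((1 - xᵢ z)(1 - xᵢ⁻¹ z))`, a power series in `z`. -/
noncomputable def hGen (x : Fin N → Rˣ) : PowerSeries R :=
  ∏ i, PowerSeries.invOfUnit
    ((1 - PowerSeries.C (x i : R) * PowerSeries.X) *
      (1 - PowerSeries.C ((x i)⁻¹ : Rˣ).val * PowerSeries.X)) 1

/-- `hₙ(x^±)`, the coefficient of `zⁿ` in `hGen x`; it is zero for `n < 0`. -/
noncomputable def h (x : Fin N → Rˣ) (n : ℤ) : R :=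
  if 0 ≤ n then PowerSeries.coeff n.toNat (hGen x) else 0

/-- The skew symplectic character `sp_{lam/mu}(x^±)` in the variables `x₁^±, …, x_N^±`, where
`lam` has `l + N` entries and `mu` has `l` entries. The column `l + 1` has the
entries `h_{lam_i - i + l + 1}`, taken once. -/
noncomputable def sp (x : Fin N → Rˣ) (lam : GenPartition (l + N)) (mu : GenPartition l) : R :=
  Matrix.det (Matrix.of fun i j : Fin (l + N) =>
    if hj : (j : ℕ) < l then
      h x (lam.part i - mu.part ⟨j, hj⟩ - pos i + pos j)
    else if pos j = l + 1 then
      h x (lam.part i - pos i + pos j)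
    else
      h x (lam.part i - pos i + pos j) + h x (lam.part i - pos i - pos j + 2 * l + 2))

/-- The skew (even) orthogonal character `o_{lam/mu}(x^±)` in the variables `x₁^±, …, x_N^±`,
where `lam` has `l + N` entries and `mu` has `l` entries. -/
noncomputable def o (x : Fin N → Rˣ) (lam : GenPartition (l + N)) (mu : GenPartition l) : R :=
  Matrix.det (Matrix.of fun i j : Fin (l + N) =>
    if hj : (j : ℕ) < l then
      h x (lam.part i - mu.part ⟨j, hj⟩ - pos i + pos j)
    else
      h x (lam.part i - pos i + pos j) - h x (lam.part i - pos i - pos j + 2 * l))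

end Characters

section Dual

variable (R : Type*) [CommRing R] {K l : ℕ}

/-- The generating function `∏ⱼ 1 / ((1 - yⱼ z)(1 - yⱼ z⁻¹))`, a power series in the
indeterminates `y₁, …, y_K` whose coefficients are Laurent polynomials in `z`. -/
noncomputable def fGen (K : ℕ) : MvPowerSeries (Fin K) R[T;T⁻¹] :=
  ∏ j, MvPowerSeries.invOfUnit
    ((1 - MvPowerSeries.C (LaurentPolynomial.T 1) * MvPowerSeries.X j) *
      (1 - MvPowerSeries.C (LaurentPolynomial.T (-1)) * MvPowerSeries.X j)) 1

/-- `fₙ(y)`, the coefficient of `zⁿ` in `fGen`, a power series in `y₁, …, y_K`. -/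
noncomputable def f (K : ℕ) (n : ℤ) : MvPowerSeries (Fin K) R :=
  fun d => (MvPowerSeries.coeff d (fGen R K)).coeff n

/-- `SP*_{al/be}(y)`, for `al` and `be` with `l` entries. -/
noncomputable def SPstar (K : ℕ) (al be : GenPartition l) : MvPowerSeries (Fin K) R :=
  Matrix.det (Matrix.of fun i j : Fin l =>
    f R K (be.part i - al.part j - pos i + pos j)
      - f R K (be.part i + al.part j - pos i - pos j + 2 * (l + 1)))

/-- `O*_{al/be}(y)`, for `al` and `be` with `l` entries. If `l ≥ 1` and the last entry of `be` is
zero, then the last row of the matrix is twice a row of power series, and the normalizing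
factor is `1/2`; otherwise the factor is `1`. -/
noncomputable def Ostar [Algebra ℚ R] (K : ℕ) (al be : GenPartition l) :
    MvPowerSeries (Fin K) R :=
  (if ∃ i : Fin l, pos i = l ∧ be.part i = 0 then (1 / 2 : ℚ) else 1) •
    Matrix.det (Matrix.of fun i j : Fin l =>
      f R K (be.part i - al.part j - pos i + pos j)
        + f R K (be.part i + al.part j - pos i - pos j + 2 * l))

end Dual

/-- The product `∏ᵢ ∏ⱼ 1 / ((1 - xᵢ yⱼ)(1 - xᵢ⁻¹ yⱼ))`, a power series in `y₁, …, y_K`. -/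
noncomputable def cauchyProd {R : Type*} [CommRing R] {N : ℕ} (x : Fin N → Rˣ) (K : ℕ) :
    MvPowerSeries (Fin K) R :=
  ∏ i, ∏ j, MvPowerSeries.invOfUnit
    ((1 - MvPowerSeries.C (x i : R) * MvPowerSeries.X j) *
      (1 - MvPowerSeries.C ((x i)⁻¹ : Rˣ).val * MvPowerSeries.X j)) 1

end SkewCauchy

/-! Fix an exponent `d` and work modulo the power series whose coefficients vanish at all exponents
`≤ d`. There `F(T) = ∑ fₙ Tⁿ` is a symmetric Laurent polynomial, hence a polynomial `qF` in `T +
T⁻¹`. Laurent polynomials act by shifts on sequences indexed by `ℤ`, and `∏ᵢ (T + T⁻¹ - dᵢ)` with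
`dᵢ = xᵢ + xᵢ⁻¹` sends `u(r) = h_{r-N}` to the delta sequence (`act_hShift`).

Encode partitions by the strictly decreasing sequences `ρᵢ + n - i`. Cauchy-Binet
(`alternating_sum_smul`) turns each of the two sums into one determinant of size `l + N`. Row `i` of
both consists of values of a functional `E i`: let a Laurent polynomial act on `u`, then fold the
result about `0` with a sign `ε`. The columns are the images of `F T^(mⱼ+a)` and `F bₖ` on the left,
and of `∑ₜ dualKernel(t, mⱼ) T^(t+a)` and `bₖ` on the right. Here `bₖ = κ pₖ(T + T⁻¹)` with `pₖ`
monic of degree `k`, where `κ = 1` in the symplectic case and `κ = T⁻¹ - T` in the orthogonal one.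

The fold kills `κ` times any symmetric Laurent polynomial, so on multiples of `κ` the functionals
factor through `A[X] / ∏ (X - dₖ)`. The first `l` columns of the two determinants differ by elements
of `κ A[T + T⁻¹]`, that is, by combinations of the last `N` columns. Those last columns differ by
multiplication by `qF`, whose norm `∏ qF(dₖ) = ∏ F(xₖ)` is the Cauchy product
(`det_sumElim_polynomial`, `skewDet_cauchy`). -/

namespace SkewCauchy

/-! ### Cauchy-Binet for alternating maps. -/

section CauchyBinet

/-- The strictly decreasing sequences of length `n` with entries in `s`. -/
noncomputable def strictSeq (n : ℕ) (s : Finset ℕ) : Finset (Fin n → ℕ) :=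
  open Classical in (Fintype.piFinset fun _ => s).filter StrictAnti

theorem mem_strictSeq {n : ℕ} {s : Finset ℕ} {q : Fin n → ℕ} :
    q ∈ strictSeq n s ↔ (∀ i, q i ∈ s) ∧ StrictAnti q := by
  simp [strictSeq]

theorem exists_strictAnti_comp_perm {n : ℕ} {p : Fin n → ℕ} (hp : Function.Injective p) :
    ∃ (q : Fin n → ℕ) (σ : Equiv.Perm (Fin n)), StrictAnti q ∧ q ∘ σ = p := by
  let e := Tuple.sort (OrderDual.toDual ∘ p)
  refine ⟨p ∘ e, e.symm, ?_, by ext; simp⟩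
  have hm : Monotone (OrderDual.toDual ∘ p ∘ e) := Tuple.monotone_sort (OrderDual.toDual ∘ p)
  have hs := hm.strictMono_of_injective
    (OrderDual.toDual.injective.comp (hp.comp e.injective))
  exact fun i j hij => hs hij

theorem strictAnti_comp_perm_inj {n : ℕ} {q q' : Fin n → ℕ} (hq : StrictAnti q)
    (hq' : StrictAnti q') {σ σ' : Equiv.Perm (Fin n)} (h : q ∘ σ = q' ∘ σ') :
    q = q' ∧ σ = σ' := by
  have hr : Set.range q = Set.range q' := by
    rw [← σ.surjective.range_comp q, h, σ'.surjective.range_comp q']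
  have hqq : q = q' := by
    have h1 : StrictMono (OrderDual.toDual ∘ q) := fun i j hij => hq hij
    have h2 : StrictMono (OrderDual.toDual ∘ q') := fun i j hij => hq' hij
    have h3 := (StrictMono.range_inj h1 h2).1 (by rw [Set.range_comp, Set.range_comp, hr])
    exact funext fun i => congrFun h3 i
  subst hqq
  exact ⟨rfl, Equiv.ext fun i => hq.injective (congrFun h i)⟩

/-- A form of the Cauchy-Binet formula. -/
theorem alternating_sum_smul {A V : Type*} [CommRing A] [AddCommGroup V] [Module A V] {n : ℕ}
    (D : V [⋀^Fin n]→ₗ[A] A) (s : Finset ℕ) (g : ℕ → Fin n → A) (v : ℕ → V) :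
    D (fun j => ∑ t ∈ s, g t j • v t) =
      ∑ q ∈ strictSeq n s, Matrix.det (Matrix.of fun i j => g (q i) j) * D (v ∘ q) := by
  classical
  have h1 : D (fun j => ∑ t ∈ s, g t j • v t) =
      ∑ p ∈ Fintype.piFinset (fun _ : Fin n => s), (∏ j, g (p j) j) * D (v ∘ p) := by
    have := D.toMultilinearMap.map_sum_finset (fun j t => g t j • v t) (fun _ => s)
    simp only [AlternatingMap.coe_multilinearMap] at this
    rw [this]
    refine Finset.sum_congr rfl fun p _ => ?_
    have := D.toMultilinearMap.map_smul_univ (fun j => g (p j) j) (fun j => v (p j))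
    simpa [Function.comp_def] using this
  have h2 : ∑ q ∈ strictSeq n s, Matrix.det (Matrix.of fun i j => g (q i) j) * D (v ∘ q) =
      ∑ x ∈ strictSeq n s ×ˢ (Finset.univ : Finset (Equiv.Perm (Fin n))),
        (∏ j, g ((x.1 ∘ x.2) j) j) * D (v ∘ (x.1 ∘ x.2)) := by
    rw [Finset.sum_product]
    refine Finset.sum_congr rfl fun q _ => ?_
    rw [Matrix.det_apply, Finset.sum_mul]
    refine Finset.sum_congr rfl fun σ _ => ?_
    have := D.map_perm (v ∘ q) σ
    rw [← Function.comp_assoc, this]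
    simp only [Matrix.of_apply, Function.comp]
    simp only [Units.smul_def, zsmul_eq_mul]
    ring
  rw [h1, h2]
  symm
  refine Finset.sum_of_injOn (fun x => x.1 ∘ x.2) ?_ ?_ ?_ ?_
  · rintro ⟨q, σ⟩ hx ⟨q', σ'⟩ hx' h
    simp only [Finset.coe_product, Set.mem_prod, Finset.mem_coe, mem_strictSeq] at hx hx'
    obtain ⟨h1, h2⟩ := strictAnti_comp_perm_inj hx.1.2 hx'.1.2 h
    exact Prod.ext h1 h2
  · rintro ⟨q, σ⟩ hx
    simp only [Finset.coe_product, Set.mem_prod, Finset.mem_coe, mem_strictSeq] at hx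
    simpa using fun a => hx.1.1 _
  -- Index functions outside the image are non-injective: an injective one sorts into a decreasing
  -- sequence and a permutation.
  · intro p hp hnot
    by_cases hinj : Function.Injective p
    · obtain ⟨q, σ, hq, rfl⟩ := exists_strictAnti_comp_perm hinj
      refine absurd ⟨(q, σ), ?_, rfl⟩ hnot
      simp only [Finset.coe_product, Set.mem_prod, Finset.mem_coe, mem_strictSeq,
        Finset.mem_univ, and_true]
      refine ⟨fun i => ?_, hq⟩
      have := Fintype.mem_piFinset.1 hp (σ.symm i)
      simpa using this
    · have : ¬ Function.Injective (v ∘ p) := fun h => hinj h.of_comp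
      rw [D.map_eq_zero_of_not_injective _ this, mul_zero]
  · intro x _
    rfl

/-- The determinant as an alternating function of its first columns. -/
noncomputable def detColsAlternating {A κ ι : Type*} [CommRing A] [Fintype κ] [DecidableEq κ]
    [Fintype ι] [DecidableEq ι] (Ψ : ι → (κ ⊕ ι) → A) : ((κ ⊕ ι) → A) [⋀^κ]→ₗ[A] A where
  toFun w := Matrix.detRowAlternating (Sum.elim w Ψ)
  map_update_add' w j x y := by
    simp only [← Sum.update_elim_inl]
    convert (Matrix.detRowAlternating (n := κ ⊕ ι) (R := A)).map_update_add
      (Sum.elim w Ψ) (Sum.inl j) x y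
  map_update_smul' w j c x := by
    simp only [← Sum.update_elim_inl]
    convert (Matrix.detRowAlternating (n := κ ⊕ ι) (R := A)).map_update_smul
      (Sum.elim w Ψ) (Sum.inl j) c x
  map_eq_zero_of_eq' w i j h hij := by
    refine (Matrix.detRowAlternating (n := κ ⊕ ι) (R := A)).map_eq_zero_of_eq
      _ (i := Sum.inl i) (j := Sum.inl j) (by simpa using h) (by simpa using hij)

theorem detColsAlternating_apply {A κ ι : Type*} [CommRing A] [Fintype κ] [DecidableEq κ]
    [Fintype ι] [DecidableEq ι] (Ψ : ι → (κ ⊕ ι) → A) (w : κ → (κ ⊕ ι) → A) :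
    detColsAlternating Ψ w =
      Matrix.det (Matrix.of fun i => Sum.elim (fun j => w j i) (fun k => Ψ k i)) := by
  rw [← Matrix.det_transpose]
  change Matrix.det _ = _
  congr 1
  ext c i
  cases c <;> simp

end CauchyBinet

/-! ### Determinants with columns in `A[X] / ∏ (X - cₖ)`. -/

section PolynomialColumns

open Polynomial

variable {A : Type*} [CommRing A] {N : ℕ}

/-- The Newton polynomials `∏_{i < k} (X - cᵢ)`. -/
noncomputable def newton (c : Fin N → A) (k : ℕ) : A[X] :=
  ∏ i : Fin N with i.val < k, (X - C (c i))

theorem newton_succ (c : Fin N → A) (k : Fin N) :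
    newton c (k + 1) = (X - C (c k)) * newton c k := by
  have : (Finset.univ.filter fun i : Fin N => i.val < k + 1) =
      insert k (Finset.univ.filter fun i : Fin N => i.val < k) := by
    ext i
    simp only [Finset.mem_filter_univ, Finset.mem_insert, Fin.ext_iff]
    omega
  rw [newton, this, Finset.prod_insert (by simp), newton]

theorem newton_self (c : Fin N → A) : newton c N = ∏ i, (X - C (c i)) := by
  simp [newton]

theorem newton_monic (c : Fin N → A) (k : ℕ) : (newton c k).Monic :=
  monic_prod_of_monic _ _ fun i _ => monic_X_sub_C (c i)

theorem newton_natDegree [Nontrivial A] (c : Fin N → A) (k : Fin N) :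
    (newton c k).natDegree = k := by
  rw [newton, natDegree_prod_of_monic _ _ fun i _ => monic_X_sub_C (c i)]
  simp only [natDegree_X_sub_C, Finset.sum_const, smul_eq_mul, mul_one]
  rw [Fin.card_filter_val_lt, min_eq_right k.isLt.le]

/-- Newton interpolation by downward induction on `k`: division of `s` by `X - cₖ` leaves the
constant `s(cₖ)` and moves the quotient to `newton c (k + 1)`. Only monic linear divisors occur, so
the `cₖ` need not be distinct and `A` need not be a domain. -/
theorem exists_newton_expansion (c : Fin N → A) {k : ℕ} (hk : k ≤ N) (s : A[X]) :
    ∃ a : Fin N → A, (∀ j : Fin N, j.val < k → a j = 0) ∧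
      ∀ lam : A[X] →ₗ[A] A, (∀ r, lam (r * ∏ i, (X - C (c i))) = 0) →
        lam (s * newton c k) = ∑ j, a j * lam (newton c j) := by
  induction hk using Nat.decreasingInduction generalizing s with
  | self =>
    refine ⟨0, fun _ _ => rfl, fun lam hlam => ?_⟩
    rw [newton_self, hlam]
    simp
  | of_succ k hk ih =>
    have hk' : k < N := hk
    obtain ⟨t, ht⟩ : (X - C (c ⟨k, hk'⟩)) ∣ s - C (s.eval (c ⟨k, hk'⟩)) :=
      X_sub_C_dvd_sub_C_eval
    obtain ⟨a, ha, hlam⟩ := ih t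
    refine ⟨a + Pi.single ⟨k, hk'⟩ (s.eval (c ⟨k, hk'⟩)), fun j hj => ?_, fun lam h => ?_⟩
    · have : j ≠ ⟨k, hk'⟩ := by rintro rfl; simp at hj
      simp [this, ha j (by omega)]
    · have hs : s * newton c k = t * newton c (k + 1) +
          (s.eval (c ⟨k, hk'⟩)) • newton c k := by
        have h1 := newton_succ c ⟨k, hk'⟩
        simp only at h1
        rw [h1, smul_eq_C_mul, mul_left_comm t, ← mul_assoc, ← ht]
        ring
      rw [hs, map_add, hlam lam h, map_smul]
      simp [add_mul, Finset.sum_add_distrib, Pi.single_apply]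

/-- In the Newton basis, multiplication by `q` is triangular with diagonal entries `q(cₖ)`; this
computes the norm. -/
theorem exists_newton_expansion_mul (c : Fin N → A) (q : A[X]) :
    ∃ Q : Matrix (Fin N) (Fin N) A, Q.det = ∏ k, q.eval (c k) ∧
      ∀ lam : A[X] →ₗ[A] A, (∀ r, lam (r * ∏ i, (X - C (c i))) = 0) →
        ∀ k : Fin N, lam (q * newton c k) = ∑ j : Fin N, lam (newton c j) * Q j k := by
  have key : ∀ k : Fin N, ∃ a : Fin N → A, (∀ j : Fin N, j < k → a j = 0) ∧
      a k = q.eval (c k) ∧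
      ∀ lam : A[X] →ₗ[A] A, (∀ r, lam (r * ∏ i, (X - C (c i))) = 0) →
        lam (q * newton c k) = ∑ j, a j * lam (newton c j) := by
    intro k
    obtain ⟨t, ht⟩ : (X - C (c k)) ∣ q - C (q.eval (c k)) := X_sub_C_dvd_sub_C_eval
    -- Starting at `k + 1` keeps the quotient's contribution strictly off the diagonal.
    obtain ⟨a, ha, hlam⟩ := exists_newton_expansion c (k := k + 1) k.isLt t
    refine ⟨a + Pi.single k (q.eval (c k)), fun j hj => ?_, ?_, fun lam h => ?_⟩
    · have hj' : j.val < k.val := hj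
      simp [hj.ne, ha j (by omega)]
    · simp [ha k (by omega)]
    · have hs : q * newton c k = t * newton c (k + 1) + (q.eval (c k)) • newton c k := by
        rw [newton_succ, smul_eq_C_mul, mul_left_comm t, ← mul_assoc, ← ht]
        ring
      rw [hs, map_add, hlam lam h, map_smul]
      simp [add_mul, Finset.sum_add_distrib, Pi.single_apply]
  choose a ha1 ha2 ha3 using key
  refine ⟨Matrix.of fun j k => a k j, ?_, fun lam h k => ?_⟩
  · rw [Matrix.det_of_isLowerTriangular (M := Matrix.of fun j k => a k j)
      (fun i j hij => ha1 j i hij)]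
    simp [ha2]
  · rw [ha3 k lam h]
    simp [mul_comm]

variable {κ : Type*} [Fintype κ] [DecidableEq κ]

theorem det_sumElim_mul (a : (κ ⊕ Fin N) → κ → A) (b : (κ ⊕ Fin N) → Fin N → A)
    (E : Matrix (Fin N) κ A) (Q : Matrix (Fin N) (Fin N) A) :
    Matrix.det (Matrix.of fun i => Sum.elim (fun j => a i j + ∑ k, b i k * E k j)
      (fun k => ∑ j, b i j * Q j k)) =
    Q.det * Matrix.det (Matrix.of fun i => Sum.elim (a i) (b i)) := by
  have : (Matrix.of fun i => Sum.elim (fun j => a i j + ∑ k, b i k * E k j)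
      (fun k => ∑ j, b i j * Q j k)) =
      (Matrix.of fun i => Sum.elim (a i) (b i)) * Matrix.fromBlocks 1 0 E Q := by
    ext i j
    cases j <;> simp [Matrix.mul_apply, Matrix.one_apply]
  rw [this, Matrix.det_mul, Matrix.det_fromBlocks_zero₁₂, Matrix.det_one, one_mul, mul_comm]

/-- The change of basis from the powers of `X` is unitriangular. Hence Chebyshev and Newton
polynomials may be exchanged freely. -/
theorem det_sumElim_monic (lam : (κ ⊕ Fin N) → A[X] →ₗ[A] A) (a : (κ ⊕ Fin N) → κ → A)
    (p : Fin N → A[X]) (hdeg : ∀ k, (p k).natDegree = k) (hmonic : ∀ k, (p k).Monic) :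
    Matrix.det (Matrix.of fun i => Sum.elim (a i) (fun k => lam i (p k))) =
    Matrix.det (Matrix.of fun i => Sum.elim (a i) (fun k => lam i (X ^ (k : ℕ)))) := by
  have h := det_sumElim_mul a (fun i k => lam i (X ^ (k : ℕ))) 0 
    (Matrix.of fun i j : Fin N => (p j).coeff i)
  rw [Matrix.det_matrixOfPolynomials p hdeg hmonic, one_mul] at h
  rw [← h]
  congr 2
  ext i j
  cases j with
  | inl j => simp
  | inr k =>
    simp only [Sum.elim_inr, Matrix.of_apply]
    conv_lhs => rw [(p k).as_sum_range' N (by rw [hdeg]; exact k.isLt), map_sum,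
      ← Fin.sum_univ_eq_sum_range (fun m => lam i (monomial m ((p k).coeff m)))]
    refine Finset.sum_congr rfl fun m _ => ?_
    rw [← C_mul_X_pow_eq_monomial, ← smul_eq_C_mul, map_smul, smul_eq_mul, mul_comm]

/-- Multiplication by `q` in the last `N` columns, where the linear functionals factor through
`A[X] / ∏ (X - cₖ)`, multiplies the determinant by the norm of `q`. -/
theorem det_sumElim_polynomial (lam : (κ ⊕ Fin N) → A[X] →ₗ[A] A) (c : Fin N → A)
    (hlam : ∀ i r, lam i (r * ∏ k, (X - C (c k))) = 0) (a : (κ ⊕ Fin N) → κ → A)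
    (p : Fin N → A[X]) (hdeg : ∀ k, (p k).natDegree = k) (hmonic : ∀ k, (p k).Monic)
    (s : κ → A[X]) (q : A[X]) :
    Matrix.det (Matrix.of fun i =>
      Sum.elim (fun j => a i j + lam i (s j)) (fun k => lam i (q * p k))) =
    (∏ k, q.eval (c k)) *
      Matrix.det (Matrix.of fun i => Sum.elim (a i) (fun k => lam i (p k))) := by
  nontriviality A
  have hN (lam : (κ ⊕ Fin N) → A[X] →ₗ[A] A) (a : (κ ⊕ Fin N) → κ → A) :
      Matrix.det (Matrix.of fun i => Sum.elim (a i) (fun k => lam i (p k))) =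
      Matrix.det (Matrix.of fun i => Sum.elim (a i) (fun k => lam i (newton c k))) := by
    rw [det_sumElim_monic lam a p hdeg hmonic, det_sumElim_monic lam a (fun k => newton c k)
      (newton_natDegree c) (fun k => newton_monic c k)]
  have h1 := hN (fun i => (lam i).comp (LinearMap.mulLeft A q)) (fun i j => a i j + lam i (s j))
  simp only [LinearMap.comp_apply, LinearMap.mulLeft_apply] at h1
  rw [h1, hN lam a]
  obtain ⟨Q, hQ, hQ'⟩ := exists_newton_expansion_mul c q
  choose E hE1 hE2 using fun j => exists_newton_expansion c (Nat.zero_le N) (s j)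
  rw [← hQ, ← det_sumElim_mul a _ (Matrix.of fun k j => E j k) Q]
  congr 2
  ext i j
  cases j with
  | inl j =>
    have := hE2 j (lam i) (hlam i)
    simp only [newton, not_lt_zero, Finset.filter_false, Finset.prod_empty, mul_one] at this
    simp [this, newton, mul_comm]
  | inr k => simpa using hQ' (lam i) (hlam i) k

end PolynomialColumns

/-! ### Laurent polynomials acting on sequences. -/

section Action

open LaurentPolynomial

variable {A : Type*} [CommRing A]

/-- The shift operators on sequences indexed by the integers. -/
def shift (A : Type*) [CommRing A] : Multiplicative ℤ →* Module.End A (ℤ → A) where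
  toFun k :=
    { toFun := fun φ r => φ (r - k.toAdd)
      map_add' := fun _ _ => rfl
      map_smul' := fun _ _ => rfl }
  map_one' := by ext; simp
  map_mul' j k := by
    refine LinearMap.ext fun φ => funext fun r => ?_
    simp only [toAdd_mul, LinearMap.coe_mk, AddHom.coe_mk, Module.End.mul_apply]
    congr 1
    ring

/-- Laurent polynomials act on sequences indexed by the integers, `T k` as the shift by `k`. -/
noncomputable def act (A : Type*) [CommRing A] : A[T;T⁻¹] →ₐ[A] Module.End A (ℤ → A) :=
  AddMonoidAlgebra.lift A _ ℤ (shift A)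

theorem act_apply (p : A[T;T⁻¹]) (φ : ℤ → A) (r : ℤ) :
    act A p φ r = p.coeff.sum fun k a => a * φ (r - k) := by
  rw [act, AddMonoidAlgebra.lift_apply, Finsupp.sum, LinearMap.sum_apply, Finset.sum_apply]
  rfl

theorem act_apply_of_subset (p : A[T;T⁻¹]) (φ : ℤ → A) (r : ℤ) {s : Finset ℤ}
    (hs : p.coeff.support ⊆ s) : act A p φ r = ∑ k ∈ s, p.coeff k * φ (r - k) := by
  rw [act_apply]
  exact Finsupp.sum_of_support_subset _ hs _ (by simp)

theorem act_T (k : ℤ) (φ : ℤ → A) (r : ℤ) : act A (T k) φ r = φ (r - k) := by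
  rw [act_apply_of_subset (s := {k})]
  · simp
  · intro m
    simp only [Finsupp.mem_support_iff, T_apply, Finset.mem_singleton]
    intro h
    by_contra h'
    exact h (if_neg (Ne.symm h'))

theorem act_C (a : A) (φ : ℤ → A) : act A (C a) φ = a • φ := by
  rw [C_eq_algebraMap, AlgHom.commutes]
  rfl

theorem act_delta (p : A[T;T⁻¹]) (r : ℤ) : act A p (Pi.single 0 1) r = p.coeff r := by
  rw [act_apply_of_subset (s := p.coeff.support ∪ {r}) _ _ _ Finset.subset_union_left]
  rw [Finset.sum_eq_single r]
  · simp
  · intro k _ hk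
    rw [Pi.single_eq_of_ne (sub_ne_zero.2 hk.symm), mul_zero]
  · simp

theorem act_eq_zero {p : A[T;T⁻¹]} {φ : ℤ → A} {a b : ℤ} (hp : ∀ k < a, p.coeff k = 0)
    (hφ : ∀ r < b, φ r = 0) {r : ℤ} (hr : r < a + b) : act A p φ r = 0 := by
  rw [act_apply]
  refine Finset.sum_eq_zero fun k _ => ?_
  by_cases hk : k < a
  · simp [hp k hk]
  · simp [hφ (r - k) (by lia)]

/-- The coefficients of a power series, extended by zero to the integers. -/
noncomputable def extCoeff (p : PowerSeries A) (n : ℤ) : A :=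
  if 0 ≤ n then PowerSeries.coeff n.toNat p else 0

theorem act_one_sub_C_mul_T (x : A) (p : PowerSeries A) :
    act A (1 - C x * T 1) (extCoeff p) =
      extCoeff ((1 - PowerSeries.C x * PowerSeries.X) * p) := by
  funext r
  rw [map_sub, map_one, map_mul, LinearMap.sub_apply, Module.End.one_apply, Module.End.mul_apply,
    act_C, Pi.sub_apply, Pi.smul_apply, act_T, sub_mul, one_mul, mul_assoc]
  rcases lt_trichotomy r 0 with h | rfl | h
  · simp [extCoeff, not_le.2 h, show ¬ 1 ≤ r by lia]
  · simp [extCoeff]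
  · obtain ⟨n, rfl⟩ : ∃ n : ℕ, r = n + 1 := ⟨r.toNat - 1, by lia⟩
    have h1 : ((n : ℤ) + 1).toNat = n + 1 := by lia
    have h2 : (0 : ℤ) ≤ n + 1 := by lia
    simp [extCoeff, h1, h2, PowerSeries.coeff_succ_X_mul]

theorem act_prod_extCoeff {N : ℕ} (x : Fin N → Aˣ) (p : PowerSeries A) :
    act A (∏ i, ((1 - C (x i : A) * T 1) * (1 - C ((x i)⁻¹ : Aˣ).val * T 1))) (extCoeff p) =
      extCoeff ((∏ i, ((1 - PowerSeries.C (x i : A) * PowerSeries.X) *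
      (1 - PowerSeries.C ((x i)⁻¹ : Aˣ).val * PowerSeries.X))) * p) := by
  generalize (Finset.univ : Finset (Fin N)) = s
  induction s using Finset.induction_on generalizing p with
  | empty => simp
  | insert i s hi ih =>
    rw [Finset.prod_insert hi, Finset.prod_insert hi, mul_comm _ (∏ i ∈ s, _), map_mul,
      Module.End.mul_apply, map_mul, Module.End.mul_apply, act_one_sub_C_mul_T,
      act_one_sub_C_mul_T, ih]
    congr 1
    ring

/-- The symmetric Laurent polynomial `T + T⁻¹`. -/
noncomputable def symT (A : Type*) [CommRing A] : A[T;T⁻¹] := T 1 + T (-1)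

theorem T_mul_symT_sub (x : Aˣ) :
    T 1 * (symT A - C ((x : A) + (x⁻¹ : Aˣ).val)) =
      (1 - C (x : A) * T 1) * (1 - C ((x)⁻¹ : Aˣ).val * T 1) := by
  have h1 : (T 1 * T (-1) : A[T;T⁻¹]) = 1 := by rw [← T_add]; simp
  have h2 : (C (x : A) * C (x⁻¹ : Aˣ).val : A[T;T⁻¹]) = 1 := by rw [← map_mul]; simp
  rw [symT, map_add]
  linear_combination h1 - T 1 * T 1 * h2

theorem hGen_mul {N : ℕ} (x : Fin N → Aˣ) :
    (∏ i, ((1 - PowerSeries.C (x i : A) * PowerSeries.X) *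
      (1 - PowerSeries.C ((x i)⁻¹ : Aˣ).val * PowerSeries.X))) * hGen x = 1 := by
  rw [hGen, ← Finset.prod_mul_distrib]
  refine Finset.prod_eq_one fun i _ => ?_
  exact PowerSeries.mul_invOfUnit _ 1 (by simp)

/-- The sequence `h_{r-N}`, `r ∈ ℤ`. -/
noncomputable def hShift {N : ℕ} (x : Fin N → Aˣ) (r : ℤ) : A := h x (r - N)

theorem hShift_eq_zero {N : ℕ} (x : Fin N → Aˣ) {r : ℤ} (hr : r < N) : hShift x r = 0 := by
  rw [hShift, h, if_neg (by lia)]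

/-- The offset by `N` absorbs the factors `T` in `T (T + T⁻¹ - xᵢ - xᵢ⁻¹) = (1 - xᵢ T)(1 - xᵢ⁻¹ T)`,
whose product is inverse to the generating function of the `hₙ`. -/
theorem act_hShift {N : ℕ} (x : Fin N → Aˣ) :
    act A (∏ i, (symT A - C ((x i : A) + ((x i)⁻¹ : Aˣ).val))) (hShift x) = Pi.single 0 1 := by
  have h1 : hShift x = act A (T N) (extCoeff (hGen x)) := by
    funext r
    rw [act_T]
    rfl
  have h2 : (∏ i, (symT A - C ((x i : A) + ((x i)⁻¹ : Aˣ).val))) * T N =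
      ∏ i, ((1 - C (x i : A) * T 1) * (1 - C ((x i)⁻¹ : Aˣ).val * T 1)) := by
    have : (T N : A[T;T⁻¹]) = ∏ _i : Fin N, T 1 := by simp [T_pow]
    rw [this, ← Finset.prod_mul_distrib]
    exact Finset.prod_congr rfl fun i _ => by rw [mul_comm, T_mul_symT_sub]
  rw [h1, ← Module.End.mul_apply, ← map_mul, h2, act_prod_extCoeff, hGen_mul]
  funext r
  rcases lt_trichotomy r 0 with h | rfl | h
  · simp [extCoeff, not_le.2 h, Pi.single_eq_of_ne h.ne]
  · simp [extCoeff]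
  · rw [Pi.single_eq_of_ne h.ne', extCoeff, if_pos h.le, PowerSeries.coeff_one,
      if_neg (by lia)]

theorem mem_of_symmetric (V : Submodule A A[T;T⁻¹]) (e : A)
    (hV : ∀ k : ℕ, T (k + 1 : ℤ) + C e * T (-(k + 1 : ℤ)) ∈ V) {S : A[T;T⁻¹]}
    (hS : ∀ k : ℕ, S.coeff (-(k + 1 : ℤ)) = e * S.coeff (k + 1 : ℤ))
    (hS0 : C (S.coeff 0) ∈ V) : S ∈ V := by
  obtain ⟨n, hn⟩ : ∃ n : ℕ, ∀ k : ℤ, n < k.natAbs → S.coeff k = 0 := by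
    refine ⟨S.coeff.support.sup Int.natAbs, fun k hk => ?_⟩
    by_contra h
    exact absurd (Finset.le_sup (f := Int.natAbs) (Finsupp.mem_support_iff.2 h)) (not_le.2 hk)
  induction n generalizing S with
  | zero =>
    convert hS0
    ext k
    by_cases hk : k = 0
    · simp [hk]
    · simp [hk, hn k (by lia)]
  | succ n ih =>
    -- Subtracting the outermost pair of terms keeps the symmetry and the constant term, and lowers
    -- the bound on the support.
    have key : S - S.coeff (n + 1 : ℤ) • (T (n + 1 : ℤ) + C e * T (-(n + 1 : ℤ))) ∈ V := by
      have hc (k : ℤ) : (S - S.coeff (n + 1 : ℤ) •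
          (T (n + 1 : ℤ) + C e * T (-(n + 1 : ℤ)))).coeff k =
          S.coeff k - S.coeff (n + 1 : ℤ) * ((if (n + 1 : ℤ) = k then 1 else 0) +
            e * (if -(n + 1 : ℤ) = k then 1 else 0)) := by
        rw [← smul_eq_C_mul, AddMonoidAlgebra.coeff_sub, AddMonoidAlgebra.coeff_smul,
          AddMonoidAlgebra.coeff_add, AddMonoidAlgebra.coeff_smul, Finsupp.sub_apply,
          Finsupp.smul_apply, Finsupp.add_apply, Finsupp.smul_apply, T_apply, T_apply]
        rfl
      refine ih (fun k => ?_) ?_ (fun k hk => ?_)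
      · rw [hc, hc, hS, if_neg (c := (n + 1 : ℤ) = -(k + 1)) (by lia),
          if_neg (c := -(n + 1 : ℤ) = k + 1) (by lia)]
        by_cases h : n = k
        · subst h
          rw [if_pos rfl, if_pos rfl]
          ring
        · rw [if_neg (by lia), if_neg (by lia)]
          ring
      · rw [hc, if_neg (by lia), if_neg (by lia)]
        simpa using hS0
      · rw [hc]
        by_cases h1 : (n + 1 : ℤ) = k
        · rw [if_pos h1, if_neg (by lia), h1]
          ring
        by_cases h2 : -(n + 1 : ℤ) = k
        · rw [if_neg h1, if_pos h2, ← h2, hS]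
          ring
        rw [if_neg h1, if_neg h2, hn k (by lia)]
        ring
    simpa using V.add_mem key (V.smul_mem (S.coeff (n + 1 : ℤ)) (hV n))

end Action

/-! ### Chebyshev polynomials in `T + T⁻¹`. -/

section Chebyshev

open Polynomial

variable {A : Type*} [CommRing A]

/-- The free constant `a` covers both families: `C₀ = 2` and `S₀ = 1`. -/
theorem natDegree_monic_of_recurrence [Nontrivial A] {P : ℕ → A[X]} {a : A} (h0 : P 0 = C a)
    (h1 : P 1 = X) (h2 : ∀ n, P (n + 2) = X * P (n + 1) - P n) (n : ℕ) :
    (P (n + 1)).natDegree = n + 1 ∧ (P (n + 1)).Monic := by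
  have key : ∀ n, (P n).degree ≤ n ∧ (P (n + 1)).degree = (n + 1 : ℕ) ∧ (P (n + 1)).Monic := by
    intro n
    induction n with
    | zero => simpa [h0, h1, monic_X] using degree_C_le
    | succ n ih =>
      obtain ⟨ih1, ih2, ih3⟩ := ih
      have hX : (X * P (n + 1)).Monic := monic_X.mul ih3
      have hXd : (X * P (n + 1)).degree = ((n + 2 : ℕ) : WithBot ℕ) := by
        rw [ih3.degree_mul, degree_X, ih2]
        norm_cast
        ring
      have hlt : (P n).degree < (X * P (n + 1)).degree := by
        rw [hXd]
        exact ih1.trans_lt (by norm_cast; lia)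
      rw [h2]
      exact ⟨ih2.le, by rw [degree_sub_eq_left_of_degree_lt hlt, hXd], hX.sub_of_left hlt⟩
  exact ⟨natDegree_eq_of_degree_eq_some (key n).2.1, (key n).2.2⟩

theorem aeval_chebyshevC (n : ℕ) :
    aeval (symT A) (Chebyshev.C A n) = LaurentPolynomial.T n + LaurentPolynomial.T (-n : ℤ) := by
  induction n using Nat.twoStepInduction with
  | zero => simp [map_ofNat, one_add_one_eq_two]
  | one => simp [symT]
  | more n ih1 ih2 =>
    have := Chebyshev.C_add_two A n
    push_cast at *
    rw [this, map_sub, map_mul, aeval_X, ih1, ih2, symT]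
    simp only [add_mul, mul_add, ← LaurentPolynomial.T_add]
    ring_nf

theorem mul_aeval_chebyshevS (n : ℕ) :
    (LaurentPolynomial.T (-1) - LaurentPolynomial.T 1) * aeval (symT A) (Chebyshev.S A n) =
      LaurentPolynomial.T (-(n + 1) : ℤ) - LaurentPolynomial.T (n + 1 : ℤ) := by
  induction n using Nat.twoStepInduction with
  | zero => simp
  | one =>
    simp only [Nat.cast_one, Chebyshev.S_one, aeval_X, symT, sub_mul, mul_add,
      ← LaurentPolynomial.T_add]
    norm_num
  | more n ih1 ih2 =>
    have := Chebyshev.S_add_two A n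
    push_cast at *
    rw [this, map_sub, map_mul, aeval_X, mul_sub, mul_left_comm, ih1, ih2, symT]
    simp only [add_mul, mul_sub, ← LaurentPolynomial.T_add]
    ring_nf

/-- This identifies the norm `∏ qF(xₖ + xₖ⁻¹)` with `∏ F(xₖ)`. -/
theorem eval₂_symT (x : Aˣ) (q : A[X]) :
    LaurentPolynomial.eval₂ (RingHom.id A) x (aeval (symT A) q) =
      q.eval ((x : A) + (x⁻¹ : Aˣ).val) := by
  have h : LaurentPolynomial.eval₂ (RingHom.id A) x (symT A) = (x : A) + (x⁻¹ : Aˣ).val := by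
    simp [symT, LaurentPolynomial.eval₂_T]
  rw [aeval_def, hom_eval₂, h, eval]
  congr 1
  ext a
  simp

end Chebyshev

/-! ### The skew Cauchy identity for a general fold. -/

section Identity

open LaurentPolynomial

variable {A : Type*} [CommRing A] {l N : ℕ}

/-- The matrix entries `c_t (F_{t-s} + ε F_{t+s+2a})` of the dual determinants. -/
noncomputable def dualKernel (F : A[T;T⁻¹]) (a : ℕ) (ε : A) (c : ℕ → A) (t s : ℕ) : A :=
  c t * (F.coeff ((t : ℤ) - s) + ε * F.coeff ((t : ℤ) + s + 2 * a))

/-- The functional `φ ↦ c_t (φ(t+a) + ε φ(-(t+a)))`. -/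
def foldEval (a : ℕ) (ε : A) (c : ℕ → A) (t : ℕ) : (ℤ → A) →ₗ[A] A :=
  c t • (LinearMap.proj ((t : ℤ) + a) + ε • LinearMap.proj (-((t : ℤ) + a)))

theorem foldEval_apply (a : ℕ) (ε : A) (c : ℕ → A) (t : ℕ) (φ : ℤ → A) :
    foldEval a ε c t φ = c t * (φ ((t : ℤ) + a) + ε * φ (-((t : ℤ) + a))) := rfl

/-- The row of the skew character determinant indexed by `t`. -/
noncomputable def skewRow (u : ℤ → A) (a : ℕ) (b : Fin N → A[T;T⁻¹]) (m : Fin l → ℕ) (t : ℕ) :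
    Fin l ⊕ Fin N → A :=
  Sum.elim (fun j => act A (T ((m j : ℤ) + a)) u ((t : ℤ) + a))
    (fun k => act A (b k) u ((t : ℤ) + a))

/-- The skew character determinant, in terms of strictly decreasing sequences. -/
noncomputable def skewDet (u : ℤ → A) (a : ℕ) (b : Fin N → A[T;T⁻¹]) (q : Fin (l + N) → ℕ)
    (m : Fin l → ℕ) : A :=
  Matrix.det (Matrix.of fun i : Fin l ⊕ Fin N => skewRow u a b m (q (finSumFinEquiv i)))

theorem act_eq_sum_range {F : A[T;T⁻¹]} {φ : ℤ → A} {a : ℤ} {B : ℕ} {r : ℤ}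
    (hφ : ∀ k < a, φ k = 0) (hF : ∀ k, B + a ≤ r - k → F.coeff k = 0) :
    act A F φ r = ∑ s ∈ Finset.range B, F.coeff (r - (s + a)) * φ (s + a) := by
  classical
  let g : ℕ → ℤ := fun s => r - (s + a)
  rw [act_apply_of_subset (s := F.coeff.support ∪ (Finset.range B).image g) _ _ _
    Finset.subset_union_left]
  rw [← Finset.sum_subset (Finset.subset_union_right (s₁ := F.coeff.support)),
    Finset.sum_image (fun i _ j _ h => by simp only [g] at h; lia)]
  · exact Finset.sum_congr rfl fun s _ => by simp [g]
  · intro k _ hk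
    by_cases h1 : r - k < a
    · rw [hφ _ h1, mul_zero]
    · by_cases h2 : B + a ≤ r - k
      · rw [hF _ h2, zero_mul]
      · refine absurd (Finset.mem_image.2 ⟨(r - k - a).toNat, ?_, ?_⟩) hk
        · rw [Finset.mem_range]
          lia
        · simp only [g]
          lia

/-- The two terms of the kernel are the values of `F φ` at `L + a` and, by the symmetry of `F`, at
`-(L + a)`. -/
theorem sum_dualKernel_mul {F : A[T;T⁻¹]} (hsym : ∀ k, F.coeff (-k) = F.coeff k) {a : ℕ} {ε : A}
    {c : ℕ → A} {φ : ℤ → A} (hφ : ∀ k < (a : ℤ), φ k = 0) {B L : ℕ}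
    (hB : ∀ k : ℤ, (B : ℤ) ≤ |k| + L → F.coeff k = 0) :
    ∑ s ∈ Finset.range B, dualKernel F a ε c L s * φ ((s : ℤ) + a) =
      foldEval a ε c L (act A F φ) := by
  rw [foldEval_apply, act_eq_sum_range (B := B) hφ fun k hk => hB k (by
    have := neg_abs_le k
    lia), act_eq_sum_range (B := B) hφ fun k hk => hB k (by
    have := neg_abs_le k
    lia), Finset.mul_sum, ← Finset.sum_add_distrib, Finset.mul_sum]
  refine Finset.sum_congr rfl fun s _ => ?_
  rw [dualKernel, show (L : ℤ) + a - (s + a) = L - s by ring,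
    show -((L : ℤ) + a) - (s + a) = -(L + s + 2 * a) by ring, hsym]
  ring

/-- The skew Cauchy identity for determinants built from a sequence `u` that is annihilated, up to
the delta sequence, by `∏ᵢ (T + T⁻¹ - cᵢ)`. -/
theorem skewDet_cauchy {u : ℤ → A} (hu : ∀ r < (N : ℤ), u r = 0) {d : Fin N → A}
    (hd : act A (∏ i, (symT A - C (d i))) u = Pi.single 0 1)
    {a : ℕ} {ε : A} {c : ℕ → A} {κ : A[T;T⁻¹]} {p : Fin N → Polynomial A}
    (hfold : ∀ t φ, (∀ r < (a : ℤ), φ r = 0) → foldEval a ε c t φ = φ ((t : ℤ) + a))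
    (hκ : ∀ t (q : Polynomial A), foldEval a ε c t (fun r => (κ * Polynomial.aeval (symT A) q).coeff r) = 0)
    (hdeg : ∀ k, (p k).natDegree = k) (hmonic : ∀ k, (p k).Monic)
    (hp : ∀ k, ∀ r < (a : ℤ) - N, (κ * Polynomial.aeval (symT A) (p k)).coeff r = 0)
    {qF : Polynomial A} {F : A[T;T⁻¹]} (hF : F = Polynomial.aeval (symT A) qF)
    (hsym : ∀ k, F.coeff (-k) = F.coeff k) {B : ℕ} {L : Fin (l + N) → ℕ} {m : Fin l → ℕ}
    (hBL : ∀ i, ∀ k : ℤ, (B : ℤ) ≤ |k| + L i → F.coeff k = 0)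
    (hfac : ∀ j, ∃ s : Polynomial A, F * T ((m j : ℤ) + a) -
      ∑ t ∈ Finset.range B, dualKernel F a ε c t (m j) • T ((t : ℤ) + a) =
        κ * Polynomial.aeval (symT A) s) :
    ∑ q ∈ strictSeq (l + N) (Finset.range B),
      skewDet u a (fun k => κ * Polynomial.aeval (symT A) (p k)) q m *
        Matrix.det (Matrix.of fun i j => dualKernel F a ε c (L i) (q j)) =
    (∏ k, qF.eval (d k)) * ∑ q ∈ strictSeq l (Finset.range B),
      skewDet u a (fun k => κ * Polynomial.aeval (symT A) (p k)) L q *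
        Matrix.det (Matrix.of fun i j => dualKernel F a ε c (q i) (m j)) := by
  choose s hs using hfac
  set b : Fin N → A[T;T⁻¹] := fun k => κ * Polynomial.aeval (symT A) (p k) with hb
  let e : Fin l ⊕ Fin N ≃ Fin (l + N) := finSumFinEquiv
  let E (i : Fin l ⊕ Fin N) : A[T;T⁻¹] →ₗ[A] A :=
    (foldEval a ε c (L (e i))).comp ((LinearMap.applyₗ u).comp (act A).toLinearMap)
  have hE i f : E i f = foldEval a ε c (L (e i)) (act A f u) := rfl
  let lam (i : Fin l ⊕ Fin N) : Polynomial A →ₗ[A] A :=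
    (E i).comp ((LinearMap.mulLeft A κ).comp (Polynomial.aeval (R := A) (symT A)).toLinearMap)
  have hlam i f : lam i f = E i (κ * Polynomial.aeval (symT A) f) := rfl
  -- The product turns `u` into the delta sequence, so what is folded is the coefficient sequence of
  -- `κ r(T + T⁻¹)`, and `hκ` applies.
  have hkill i r : lam i (r * ∏ k, (Polynomial.X - Polynomial.C (d k))) = 0 := by
    rw [hlam, hE, map_mul (Polynomial.aeval (symT A)), ← mul_assoc, map_mul (act A),
      Module.End.mul_apply, map_prod]
    simp only [map_sub, Polynomial.aeval_X, Polynomial.aeval_C, ← C_eq_algebraMap]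
    rw [hd]
    convert hκ (L (e i)) r using 2
    exact funext fun k => act_delta _ k
  have hT (t : ℕ) : ∀ r < (a : ℤ), act A (T ((t : ℤ) + a)) u r = 0 := fun r hr => by
    rw [act_T]
    exact hu _ (by lia)
  -- The support of `b k` starts at `a - N` or later and that of `u` at `N` or later.
  have hbu (k : Fin N) : ∀ r < (a : ℤ), act A (b k) u r = 0 := fun r hr =>
    act_eq_zero (hp k) hu (by lia)
  have hleft : ∑ q ∈ strictSeq (l + N) (Finset.range B), skewDet u a b q m *
      Matrix.det (Matrix.of fun i j => dualKernel F a ε c (L i) (q j)) =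
      Matrix.det (Matrix.of fun i => Sum.elim (fun j => E i (F * T ((m j : ℤ) + a)))
        (fun k => E i (F * b k))) := by
    have h := alternating_sum_smul
      ((Matrix.detRowAlternating (n := Fin l ⊕ Fin N) (R := A)).domDomCongr e)
      (Finset.range B) (fun t j => dualKernel F a ε c (L j) t) (skewRow u a b m)
    have h1 : ((Matrix.detRowAlternating (n := Fin l ⊕ Fin N) (R := A)).domDomCongr e)
        (fun j => ∑ t ∈ Finset.range B, dualKernel F a ε c (L j) t • skewRow u a b m t) =
        Matrix.det (Matrix.of fun i => Sum.elim (fun j => E i (F * T ((m j : ℤ) + a)))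
          (fun k => E i (F * b k))) := by
      rw [AlternatingMap.domDomCongr_apply]
      change Matrix.det _ = _
      congr 1
      ext i j
      cases j with
      | inl j =>
        simp only [Function.comp_apply, Finset.sum_apply, Pi.smul_apply, skewRow, Sum.elim_inl,
          smul_eq_mul, Matrix.of_apply]
        rw [sum_dualKernel_mul hsym (hT (m j)) (hBL (e i)), hE, map_mul (act A)]
        rfl
      | inr k =>
        simp only [Function.comp_apply, Finset.sum_apply, Pi.smul_apply, skewRow, Sum.elim_inr,
          smul_eq_mul, Matrix.of_apply]
        rw [sum_dualKernel_mul hsym (hbu k) (hBL (e i)), hE, map_mul (act A) F]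
        rfl
    rw [← h1, h]
    refine Finset.sum_congr rfl fun q _ => ?_
    rw [mul_comm, ← Matrix.det_transpose]
    rfl
  -- Here only the first `l` columns are expanded. By `hfold`, plain evaluation at `L + a` agrees
  -- with the folded one on these sequences.
  have hright : ∑ q ∈ strictSeq l (Finset.range B), skewDet u a b L q *
      Matrix.det (Matrix.of fun i j => dualKernel F a ε c (q i) (m j)) =
      Matrix.det (Matrix.of fun i => Sum.elim
        (fun j => E i (∑ t ∈ Finset.range B, dualKernel F a ε c t (m j) • T ((t : ℤ) + a)))
        (fun k => lam i (p k))) := by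
    have h := alternating_sum_smul
      (detColsAlternating (fun k (i : Fin l ⊕ Fin N) => act A (b k) u ((L (e i) : ℤ) + a)))
      (Finset.range B) (fun t j => dualKernel F a ε c t (m j))
      (fun t (i : Fin l ⊕ Fin N) => act A (T ((t : ℤ) + a)) u ((L (e i) : ℤ) + a))
    simp only [detColsAlternating_apply] at h
    refine Eq.trans ?_ (h.symm.trans ?_)
    · refine Finset.sum_congr rfl fun q _ => ?_
      rw [mul_comm]
      rfl
    · congr 2
      ext i j
      cases j with
      | inl j =>
        simp only [Sum.elim_inl, Finset.sum_apply, Pi.smul_apply, map_sum, map_smul]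
        refine Finset.sum_congr rfl fun t _ => ?_
        rw [hE, hfold _ _ (hT t)]
      | inr k =>
        simp only [Sum.elim_inr]
        rw [hlam, hE, hfold _ _ (hbu k)]
  rw [hleft, hright, ← det_sumElim_polynomial lam d hkill _ p hdeg hmonic s qF]
  congr 2
  ext i j
  cases j with
  | inl j =>
    simp only [Sum.elim_inl]
    rw [hlam, ← hs, map_sub]
    ring
  | inr k =>
    simp only [Sum.elim_inr]
    rw [hlam, map_mul (Polynomial.aeval (symT A)), ← hF, hb, mul_left_comm]

end Identity

/-! ### The symplectic and the orthogonal fold. -/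

section Cases

open LaurentPolynomial

variable {A : Type*} [CommRing A] {l N : ℕ}

theorem coeff_aeval_symT_neg (q : Polynomial A) (k : ℤ) :
    (Polynomial.aeval (symT A) q).coeff (-k) = (Polynomial.aeval (symT A) q).coeff k := by
  rw [← invert_apply]
  congr 2
  have h : invert (symT A) = symT A := by simp [symT, add_comm]
  conv_rhs => rw [← h]
  exact (Polynomial.aeval_algHom_apply (invert (R := A)).toAlgHom (symT A) q).symm

theorem coeff_antisymmetric_mul_neg (q : Polynomial A) (k : ℤ) :
    ((T (-1) - T 1) * Polynomial.aeval (symT A) q).coeff (-k) =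
      -((T (-1) - T 1) * Polynomial.aeval (symT A) q).coeff k := by
  rw [← invert_apply, map_mul, map_sub, invert_T, invert_T, neg_neg]
  have h : invert (Polynomial.aeval (symT A) q) = Polynomial.aeval (symT A) q := by
    ext k
    rw [invert_apply, coeff_aeval_symT_neg]
  rw [h, ← neg_sub, neg_mul, AddMonoidAlgebra.coeff_neg, Finsupp.neg_apply]

theorem exists_aeval_symT {F : A[T;T⁻¹]} (hF : ∀ k : ℕ, F.coeff (-(k + 1 : ℤ)) = F.coeff (k + 1)) :
    ∃ q : Polynomial A, F = Polynomial.aeval (symT A) q := by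
  have := mem_of_symmetric (LinearMap.range (Polynomial.aeval (R := A) (symT A)).toLinearMap) 1
    (fun k => ⟨Polynomial.Chebyshev.C A (k + 1 : ℕ), ?_⟩) (S := F) (by simpa using hF)
    ⟨Polynomial.C (F.coeff 0), ?_⟩
  · obtain ⟨q, hq⟩ := this
    exact ⟨q, hq.symm⟩
  · rw [AlgHom.toLinearMap_apply, aeval_chebyshevC]
    simp
  · rw [AlgHom.toLinearMap_apply, Polynomial.aeval_C, C_eq_algebraMap]

theorem exists_antisymmetric_mul_aeval_symT {F : A[T;T⁻¹]}
    (hF : ∀ k : ℕ, F.coeff (-(k + 1 : ℤ)) = -F.coeff (k + 1)) (hF0 : F.coeff 0 = 0) :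
    ∃ q : Polynomial A, F = (T (-1) - T 1) * Polynomial.aeval (symT A) q := by
  have := mem_of_symmetric (LinearMap.range ((LinearMap.mulLeft A (T (-1) - T 1)).comp
    (Polynomial.aeval (R := A) (symT A)).toLinearMap)) (-1)
    (fun k => ⟨-Polynomial.Chebyshev.S A k, ?_⟩) (S := F) (by simpa using hF)
    (by simp [hF0])
  · obtain ⟨q, hq⟩ := this
    exact ⟨q, hq.symm⟩
  · rw [LinearMap.comp_apply, AlgHom.toLinearMap_apply, map_neg, LinearMap.mulLeft_apply, mul_neg,
      mul_aeval_chebyshevS]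
    simp [sub_eq_add_neg]

/-- The truncation at `B` loses nothing, since the kernel vanishes for `t ≥ B`. The formula is used
to see that the difference is symmetric or antisymmetric. -/
theorem coeff_sub_sum_dualKernel {F : A[T;T⁻¹]} {a : ℕ} {ε : A} {c : ℕ → A} {B s : ℕ}
    (hB : ∀ k : ℤ, (B : ℤ) ≤ |k| + s → F.coeff k = 0) (k : ℤ) :
    (F * T ((s : ℤ) + a) -
      ∑ t ∈ Finset.range B, dualKernel F a ε c t s • T ((t : ℤ) + a)).coeff k =
    F.coeff (k - (s + a)) -
      if (a : ℤ) ≤ k then dualKernel F a ε c (k - a).toNat s else 0 := by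
  have h1 : (F * T ((s : ℤ) + a)).coeff k = F.coeff (k - (s + a)) := by
    have := act_delta (F * T ((s : ℤ) + a)) k
    rw [mul_comm, map_mul, Module.End.mul_apply, act_T, act_delta] at this
    rw [this, mul_comm]
  have h2 (t : ℕ) : (dualKernel F a ε c t s • T ((t : ℤ) + a) : A[T;T⁻¹]).coeff k =
      if (t : ℤ) + a = k then dualKernel F a ε c t s else 0 := by
    rw [AddMonoidAlgebra.coeff_smul, Finsupp.smul_apply, T_apply]
    simp
  rw [AddMonoidAlgebra.coeff_sub, Finsupp.sub_apply, h1, AddMonoidAlgebra.coeff_sum,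
    Finsupp.finsetSum_apply]
  simp only [h2]
  congr 1
  split_ifs with hk
  · by_cases hkB : (k - a).toNat < B
    · rw [Finset.sum_eq_single_of_mem (k - a).toNat (Finset.mem_range.2 hkB)
        fun t _ ht => if_neg (by lia), if_pos (by lia)]
    · rw [Finset.sum_eq_zero fun t ht => if_neg (by
        have := Finset.mem_range.1 ht
        lia)]
      have h3 := le_abs_self (((k - a).toNat : ℤ) - s)
      have h4 := le_abs_self (((k - a).toNat : ℤ) + s + 2 * a)
      rw [dualKernel, hB _ (by lia), hB _ (by lia)]
      ring
  · exact Finset.sum_eq_zero fun t ht => if_neg (by lia)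

theorem prod_eval₂_eq {F : A[T;T⁻¹]} {q : Polynomial A} (hq : F = Polynomial.aeval (symT A) q)
    (x : Fin N → Aˣ) :
    ∏ k, q.eval ((x k : A) + ((x k)⁻¹ : Aˣ).val) = ∏ k, eval₂ (RingHom.id A) (x k) F := by
  simp only [hq, eval₂_symT]

/-- The Laurent polynomials of the last `N` columns of the symplectic determinant. -/
noncomputable def spCol (A : Type*) [CommRing A] (k : Fin N) : A[T;T⁻¹] :=
  if (k : ℕ) = 0 then 1 else T (k : ℤ) + T (-(k : ℤ))

/-- The Laurent polynomials of the last `N` columns of the orthogonal determinant. -/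
noncomputable def oCol (A : Type*) [CommRing A] (k : Fin N) : A[T;T⁻¹] :=
  T (-(k + 1 : ℤ)) - T (k + 1 : ℤ)

theorem skewDet_cauchy_symplectic (x : Fin N → Aˣ) {F : A[T;T⁻¹]}
    (hsym : ∀ k, F.coeff (-k) = F.coeff k) {B : ℕ} {L : Fin (l + N) → ℕ} {m : Fin l → ℕ}
    (hBL : ∀ i, ∀ k : ℤ, (B : ℤ) ≤ |k| + L i → F.coeff k = 0)
    (hBm : ∀ i, ∀ k : ℤ, (B : ℤ) ≤ |k| + m i → F.coeff k = 0) :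
    ∑ q ∈ strictSeq (l + N) (Finset.range B), skewDet (hShift x) 1 (spCol A) q m *
        Matrix.det (Matrix.of fun i j => dualKernel F 1 (-1) 1 (L i) (q j)) =
    (∏ k, eval₂ (RingHom.id A) (x k) F) * ∑ q ∈ strictSeq l (Finset.range B),
      skewDet (hShift x) 1 (spCol A) L q *
        Matrix.det (Matrix.of fun i j => dualKernel F 1 (-1) 1 (q i) (m j)) := by
  nontriviality A
  obtain ⟨qF, hF⟩ := exists_aeval_symT (F := F) fun k => hsym _
  -- `C₀ = 2` is not monic; replacing it by `1` matches column `l + 1`, which takes its `h` only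
  -- once.
  let p (k : Fin N) : Polynomial A :=
    if (k : ℕ) = 0 then 1 else Polynomial.Chebyshev.C A (k : ℕ)
  have hp (k : Fin N) : (p k).natDegree = k ∧ (p k).Monic := by
    by_cases hk : (k : ℕ) = 0
    · simp [p, hk]
    · obtain ⟨n, hn⟩ := Nat.exists_eq_succ_of_ne_zero hk
      simp only [p, hk, if_false]
      rw [hn]
      refine natDegree_monic_of_recurrence (P := fun n : ℕ => Polynomial.Chebyshev.C A n) (a := 2)
        ?_ ?_ (fun n => ?_) n
      · simpa using (map_ofNat Polynomial.C 2).symm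
      · simp
      · simp [Polynomial.Chebyshev.C_add_two]
  have hcol : spCol A = fun k => 1 * Polynomial.aeval (symT A) (p k) := by
    funext k
    by_cases hk : (k : ℕ) = 0
    · simp [p, spCol, hk]
    · simp only [p, spCol, hk, if_false, one_mul, aeval_chebyshevC]
  rw [← prod_eval₂_eq hF, hcol]
  refine skewDet_cauchy (fun r => hShift_eq_zero x) (act_hShift x) (fun t φ hφ => ?_)
    (fun t q => ?_) (fun k => (hp k).1) (fun k => (hp k).2) (fun k r hr => ?_) hF hsym hBL
    (fun j => ?_)
  · rw [foldEval_apply, hφ (-((t : ℤ) + (1 : ℕ))) (by lia)]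
    simp
  · rw [foldEval_apply, one_mul, coeff_aeval_symT_neg]
    simp
  · have := congrFun hcol k
    rw [← this, spCol]
    have hk := k.isLt
    split_ifs with h
    · rw [← T_zero, T_apply, if_neg (by lia)]
    · rw [AddMonoidAlgebra.coeff_add, Finsupp.add_apply, T_apply, T_apply, if_neg (by lia),
        if_neg (by lia), add_zero]
  -- For `k ≥ 1` the `F_{k-1-s}` terms cancel, which leaves `F_{k+s+1}` at `k`, the same as at `-k`.
  · simp only [one_mul]
    refine exists_aeval_symT fun k => ?_
    rw [coeff_sub_sum_dualKernel (hBm j), coeff_sub_sum_dualKernel (hBm j), if_neg (by lia),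
      if_pos (by lia), dualKernel, ← hsym]
    have h1 : (((k : ℤ) + 1 - (1 : ℕ)).toNat : ℤ) = k := by lia
    rw [h1]
    push_cast
    simp only [Pi.one_apply]
    ring_nf

theorem skewDet_cauchy_orthogonal (x : Fin N → Aˣ) {F : A[T;T⁻¹]}
    (hsym : ∀ k, F.coeff (-k) = F.coeff k) {c : ℕ → A} (hc0 : 2 * c 0 = 1)
    (hc : ∀ t, t ≠ 0 → c t = 1) {B : ℕ} {L : Fin (l + N) → ℕ} {m : Fin l → ℕ}
    (hBL : ∀ i, ∀ k : ℤ, (B : ℤ) ≤ |k| + L i → F.coeff k = 0)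
    (hBm : ∀ i, ∀ k : ℤ, (B : ℤ) ≤ |k| + m i → F.coeff k = 0) :
    ∑ q ∈ strictSeq (l + N) (Finset.range B), skewDet (hShift x) 0 (oCol A) q m *
        Matrix.det (Matrix.of fun i j => dualKernel F 0 1 c (L i) (q j)) =
    (∏ k, eval₂ (RingHom.id A) (x k) F) * ∑ q ∈ strictSeq l (Finset.range B),
      skewDet (hShift x) 0 (oCol A) L q *
        Matrix.det (Matrix.of fun i j => dualKernel F 0 1 c (q i) (m j)) := by
  nontriviality A
  obtain ⟨qF, hF⟩ := exists_aeval_symT (F := F) fun k => hsym _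
  have hp (k : Fin N) : (Polynomial.Chebyshev.S A (k : ℕ)).natDegree = k ∧
      (Polynomial.Chebyshev.S A (k : ℕ)).Monic := by
    by_cases hk : (k : ℕ) = 0
    · simp [hk]
    · obtain ⟨n, hn⟩ := Nat.exists_eq_succ_of_ne_zero hk
      rw [hn]
      refine natDegree_monic_of_recurrence (P := fun n : ℕ => Polynomial.Chebyshev.S A n) (a := 1)
        ?_ ?_ (fun n => ?_) n
      · simp
      · simp
      · simp [Polynomial.Chebyshev.S_add_two]
  have hcol : oCol A = fun k : Fin N => (T (-1) - T 1) *
      Polynomial.aeval (symT A) (Polynomial.Chebyshev.S A (k : ℕ)) := by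
    funext k
    rw [mul_aeval_chebyshevS, oCol]
  rw [← prod_eval₂_eq hF, hcol]
  refine skewDet_cauchy (fun r => hShift_eq_zero x) (act_hShift x) (fun t φ hφ => ?_)
    (fun t q => ?_) (fun k => (hp k).1) (fun k => (hp k).2) (fun k r hr => ?_) hF hsym hBL
    (fun j => ?_)
  · rw [foldEval_apply]
    -- At `t = 0` the two points of the fold coincide, and `c 0 = 1/2` corrects the doubling.
    by_cases ht : t = 0
    · subst ht
      simp only [Nat.cast_zero, add_zero, neg_zero]
      linear_combination (φ 0) * hc0
    · rw [hc t ht, hφ (-((t : ℤ) + (0 : ℕ))) (by lia)]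
      simp
  · rw [foldEval_apply, coeff_antisymmetric_mul_neg]
    simp
  · have := congrFun hcol k
    rw [← this, oCol]
    have hk := k.isLt
    rw [AddMonoidAlgebra.coeff_sub, Finsupp.sub_apply, T_apply, T_apply, if_neg (by omega),
      if_neg (by omega), sub_zero]
  -- For `k ≥ 1` the coefficient at `k` is `-F_{k+s}` and the one at `-k` is `F_{k+s}`; the constant
  -- term vanishes because `2 * c 0 = 1`.
  · refine exists_antisymmetric_mul_aeval_symT (fun k => ?_) ?_
    · rw [coeff_sub_sum_dualKernel (hBm j), coeff_sub_sum_dualKernel (hBm j), if_neg (by lia),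
        if_pos (by lia), dualKernel, ← hsym, hc _ (by lia)]
      have h1 : (((k : ℤ) + 1 - (0 : ℕ)).toNat : ℤ) = k + 1 := by lia
      rw [h1]
      push_cast
      ring_nf
    · rw [coeff_sub_sum_dualKernel (hBm j), if_pos (by lia), dualKernel]
      have h1 : ((0 : ℤ) - (0 : ℕ)).toNat = 0 := by lia
      rw [h1]
      have h2 := hsym (m j)
      simp only [Nat.cast_zero, add_zero, zero_sub, mul_zero, zero_add, h2]
      linear_combination (-F.coeff (m j)) * hc0

end Cases

/-! ### Generalized partitions as strictly decreasing sequences. -/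

section Sequences

variable {n : ℕ}

/-- The strictly decreasing sequence `ρᵢ + n - i` of a generalized partition. -/
def GenPartition.seq (ρ : GenPartition n) (i : Fin n) : ℕ := ρ.part i + (n - 1 - i)

theorem GenPartition.seq_cast (ρ : GenPartition n) (i : Fin n) :
    (ρ.seq i : ℤ) = ρ.part i + n - pos i := by
  have := i.isLt
  rw [GenPartition.seq, pos]
  lia

theorem GenPartition.seq_strictAnti (ρ : GenPartition n) : StrictAnti ρ.seq := by
  intro i j hij
  have h1 := ρ.antitone hij.le
  have h2 : (i : ℕ) < j := hij
  have h3 := j.isLt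
  simp only [GenPartition.seq]
  lia

theorem GenPartition.seq_injective : Function.Injective (GenPartition.seq (n := n)) := by
  rintro ⟨p, hp⟩ ⟨q, hq⟩ h
  congr 1
  funext i
  simpa [GenPartition.seq] using congrFun h i

theorem StrictAnti.add_le {q : Fin n → ℕ} (hq : StrictAnti q) {i j : Fin n} (hij : i ≤ j) :
    q j + (j - i : ℕ) ≤ q i := by
  obtain ⟨k, hk⟩ : ∃ k : ℕ, (j : ℕ) = i + k := ⟨j - i, by have : (i : ℕ) ≤ j := hij; lia⟩
  induction k generalizing j with
  | zero =>
    obtain rfl : j = i := Fin.ext hk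
    simp
  | succ k ih =>
    have hj := j.isLt
    let j' : Fin n := ⟨i + k, by lia⟩
    have h1 := ih (j := j') (Fin.le_def.2 (by simp [j'])) rfl
    have h2 : q j < q j' := hq (Fin.lt_def.2 (by simp only [j']; lia))
    simp only [j'] at h1 h2
    lia

theorem GenPartition.exists_seq_eq {q : Fin n → ℕ} (hq : StrictAnti q) :
    ∃ ρ : GenPartition n, ρ.seq = q := by
  refine ⟨⟨fun i => q i - (n - 1 - i), fun i j hij => ?_⟩, funext fun i => ?_⟩
  · have h1 := StrictAnti.add_le hq hij
    have h2 : (i : ℕ) ≤ j := hij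
    have h3 := j.isLt
    simp only
    lia
  · have hi := i.isLt
    -- Comparison with the last entry gives `n - 1 - i ≤ q i`, so the natural subtraction does not
    -- truncate.
    have h1 := StrictAnti.add_le hq (i := i) (j := ⟨n - 1, by lia⟩) (Fin.le_def.2 (by simp; lia))
    simp only [GenPartition.seq]
    simp only at h1
    lia

/-- The generalized partitions whose strictly decreasing sequence is bounded by `B`. -/
noncomputable def boundedPartitions (n B : ℕ) : Finset (GenPartition n) :=
  (strictSeq n (Finset.range B)).preimage GenPartition.seq GenPartition.seq_injective.injOn

theorem exists_le_of_notMem_boundedPartitions {B : ℕ} {ρ : GenPartition n}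
    (h : ρ ∉ boundedPartitions n B) : ∃ i, B ≤ ρ.seq i := by
  by_contra! h'
  exact h (by simpa [boundedPartitions, mem_strictSeq] using ⟨h', ρ.seq_strictAnti⟩)

theorem sum_boundedPartitions {M : Type*} [AddCommMonoid M] (B : ℕ) (g : (Fin n → ℕ) → M) :
    ∑ ρ ∈ boundedPartitions n B, g ρ.seq = ∑ q ∈ strictSeq n (Finset.range B), g q := by
  refine Finset.sum_preimage _ _ _ _ fun q hq hnot => ?_
  exact absurd (GenPartition.exists_seq_eq (mem_strictSeq.1 hq).2) hnot

end Sequences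

/-! ### The characters `sp` and `o` as `skewDet`. -/

section SkewCharacters

open LaurentPolynomial

variable {R : Type*} [CommRing R] {l N : ℕ}

theorem pos_castAdd (j : Fin l) : pos (Fin.castAdd N j) = pos j := rfl

theorem pos_natAdd (k : Fin N) : pos (Fin.natAdd l k) = l + k + 1 := by
  simp [pos]

theorem sp_eq_skewDet (x : Fin N → Rˣ) (lam : GenPartition (l + N)) (mu : GenPartition l) :
    sp x lam mu = skewDet (hShift x) 1 (spCol R) lam.seq mu.seq := by
  rw [sp, ← Matrix.det_submatrix_equiv_self (finSumFinEquiv (m := l) (n := N)), skewDet]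
  congr 1
  ext i j
  have hi := lam.seq_cast (finSumFinEquiv i)
  cases j with
  | inl j =>
    have hj := mu.seq_cast j
    simp only [Matrix.submatrix_apply, Matrix.of_apply, finSumFinEquiv_apply_left, skewRow,
      Sum.elim_inl, act_T, hShift, Fin.val_castAdd, j.isLt, dif_pos, pos_castAdd, hi, hj]
    congr 1
    push_cast
    ring
  | inr k =>
    simp only [Matrix.submatrix_apply, Matrix.of_apply, finSumFinEquiv_apply_right, skewRow,
      Sum.elim_inr, Fin.val_natAdd, pos_natAdd, hi, spCol]
    rw [dif_neg (by lia)]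
    by_cases hk : (k : ℕ) = 0
    · simp only [hk, if_true, map_one, Module.End.one_apply, hShift]
      rw [if_pos (by simp)]
      congr 1
      push_cast
      ring
    · rw [if_neg (by lia), if_neg hk, map_add, LinearMap.add_apply, Pi.add_apply, act_T, act_T,
        add_comm, hShift, hShift]
      congr 2 <;> (push_cast; ring)

theorem o_eq_skewDet (x : Fin N → Rˣ) (lam : GenPartition (l + N)) (mu : GenPartition l) :
    o x lam mu = skewDet (hShift x) 0 (oCol R) lam.seq mu.seq := by
  rw [o, ← Matrix.det_submatrix_equiv_self (finSumFinEquiv (m := l) (n := N)), skewDet]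
  congr 1
  ext i j
  have hi := lam.seq_cast (finSumFinEquiv i)
  cases j with
  | inl j =>
    have hj := mu.seq_cast j
    simp only [Matrix.submatrix_apply, Matrix.of_apply, finSumFinEquiv_apply_left, skewRow,
      Sum.elim_inl, act_T, hShift, Fin.val_castAdd, j.isLt, dif_pos, pos_castAdd, hi, hj]
    congr 1
    push_cast
    ring
  | inr k =>
    simp only [Matrix.submatrix_apply, Matrix.of_apply, finSumFinEquiv_apply_right, skewRow,
      Sum.elim_inr, Fin.val_natAdd, pos_natAdd, hi, oCol]
    rw [dif_neg (by lia), map_sub, LinearMap.sub_apply, Pi.sub_apply, act_T, act_T, hShift, hShift]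
    congr 2 <;> (push_cast; ring)

theorem skewDet_eq_zero (x : Fin N → Rˣ) (a : ℕ) (b : Fin N → R[T;T⁻¹]) {q : Fin (l + N) → ℕ}
    {m : Fin l → ℕ} {j : Fin l} (hj : ∀ i, q i < m j) : skewDet (hShift x) a b q m = 0 := by
  refine Matrix.det_eq_zero_of_column_eq_zero (Sum.inl j) fun i => ?_
  have := hj (finSumFinEquiv i)
  simp only [skewRow, Matrix.of_apply, Sum.elim_inl, act_T]
  exact hShift_eq_zero x (by lia)

end SkewCharacters

/-! ### Compatibility of the characters with ring homomorphisms. -/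

section BaseChange

variable {R S : Type*} [CommRing R] [CommRing S] {l N : ℕ}

theorem map_invOfUnit_one {σ : Type*} (φ : R →+* S) {p : MvPowerSeries σ R}
    (hp : MvPowerSeries.constantCoeff p = 1) :
    MvPowerSeries.map φ (MvPowerSeries.invOfUnit p 1) =
      MvPowerSeries.invOfUnit (MvPowerSeries.map φ p) 1 := by
  refine left_inv_eq_right_inv (a := MvPowerSeries.map φ p) ?_ ?_
  · rw [← map_mul, MvPowerSeries.invOfUnit_mul _ _ (by simpa using hp), map_one]
  · exact MvPowerSeries.mul_invOfUnit _ _ (by simp [hp])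

theorem map_h (φ : R →+* S) (x : Fin N → Rˣ) (n : ℤ) :
    φ (h x n) = h (fun i => Units.map φ (x i)) n := by
  have : PowerSeries.map φ (hGen x) = hGen (fun i => Units.map φ (x i)) := by
    rw [hGen, hGen, map_prod]
    refine Finset.prod_congr rfl fun i _ => ?_
    refine (map_invOfUnit_one φ (p := (1 - PowerSeries.C (x i : R) * PowerSeries.X) *
      (1 - PowerSeries.C ((x i)⁻¹ : Rˣ).val * PowerSeries.X)) ?_).trans ?_
    · change PowerSeries.constantCoeff _ = _
      simp
    · change PowerSeries.invOfUnit (PowerSeries.map φ _) 1 = _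
      simp
  rw [h, h, ← this]
  split_ifs <;> simp

theorem map_sp (φ : R →+* S) (x : Fin N → Rˣ) (lam : GenPartition (l + N))
    (mu : GenPartition l) :
    φ (sp x lam mu) = sp (fun i => Units.map φ (x i)) lam mu := by
  rw [sp, sp, RingHom.map_det]
  congr 1
  ext i j
  simp only [RingHom.mapMatrix_apply, Matrix.map_apply, Matrix.of_apply]
  split_ifs <;> simp [map_h]

theorem map_o (φ : R →+* S) (x : Fin N → Rˣ) (lam : GenPartition (l + N))
    (mu : GenPartition l) :
    φ (o x lam mu) = o (fun i => Units.map φ (x i)) lam mu := by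
  rw [o, o, RingHom.map_det]
  congr 1
  ext i j
  simp only [RingHom.mapMatrix_apply, Matrix.map_apply, Matrix.of_apply]
  split_ifs <;> simp [map_h]

end BaseChange

/-! ### Reduction of convergence to quotient rings. -/

section Truncation

variable {σ R : Type*} [CommRing R]

/-- The ideal of the power series whose coefficients vanish at all exponents below `d`. -/
def coeffIdeal (R : Type*) [CommRing R] (d : σ →₀ ℕ) : Ideal (MvPowerSeries σ R) where
  carrier := {p | ∀ e ≤ d, MvPowerSeries.coeff e p = 0}
  add_mem' hp hq e he := by rw [map_add, hp e he, hq e he, add_zero]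
  zero_mem' e _ := map_zero _
  smul_mem' c p hp e he := by
    classical
    rw [smul_eq_mul, MvPowerSeries.coeff_mul]
    refine Finset.sum_eq_zero fun x hx => ?_
    have hx' : x.2 ≤ e := Finset.HasAntidiagonal.mem_antidiagonal.1 hx ▸ le_add_self
    rw [hp x.2 (hx'.trans he), mul_zero]

/-- Convergence is coefficientwise, and the coefficient at `d` is visible modulo `coeffIdeal R d`,
where the sum is finite. -/
theorem hasSum_of_quotient [TopologicalSpace R] {ι : Type*} {g : ι → MvPowerSeries σ R}
    {G : MvPowerSeries σ R}
    (H : ∀ d, ∃ S : Finset ι, (∀ i ∉ S, Ideal.Quotient.mk (coeffIdeal R d) (g i) = 0) ∧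
      Ideal.Quotient.mk (coeffIdeal R d) (∑ i ∈ S, g i) = Ideal.Quotient.mk (coeffIdeal R d) G) :
    HasSum g G := by
  rw [MvPowerSeries.WithPiTopology.hasSum_iff_hasSum_coeff]
  intro d
  obtain ⟨S, h1, h2⟩ := H d
  have h3 := (Ideal.Quotient.eq.1 h2) d le_rfl
  rw [map_sub, sub_eq_zero, map_sum] at h3
  rw [← h3]
  exact hasSum_sum_of_ne_finset_zero fun i hi => Ideal.Quotient.eq_zero_iff_mem.1 (h1 i hi) d le_rfl

end Truncation

/-! ### The series `fₙ` and the dual determinants. -/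

section DualSeries

open LaurentPolynomial

variable (R : Type*) [CommRing R] (K : ℕ)

theorem coeff_f (n : ℤ) (e : Fin K →₀ ℕ) :
    MvPowerSeries.coeff e (f R K n) = (MvPowerSeries.coeff e (fGen R K)).coeff n := rfl

theorem map_fGen_invert :
    MvPowerSeries.map (invert (R := R)).toRingHom (fGen R K) = fGen R K := by
  rw [fGen, map_prod]
  refine Finset.prod_congr rfl fun j _ => ?_
  rw [map_invOfUnit_one _ (by simp)]
  congr 1
  simp [mul_comm]

theorem f_neg (n : ℤ) : f R K (-n) = f R K n := by
  ext e
  rw [coeff_f, coeff_f, ← invert_apply]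
  conv_rhs => rw [← map_fGen_invert]
  rfl

/-- Only finitely many exponents lie below `d`, and the coefficient of `fGen` at each is a Laurent
polynomial. -/
theorem exists_f_mem_coeffIdeal (d : Fin K →₀ ℕ) :
    ∃ B : ℕ, ∀ n : ℤ, (B : ℤ) ≤ |n| → f R K n ∈ coeffIdeal R d := by
  refine ⟨(Finset.Iic d).sup (fun e => (MvPowerSeries.coeff e (fGen R K)).coeff.support.sup
    Int.natAbs) + 1, fun n hn e he => ?_⟩
  by_contra h
  have h1 := Finset.le_sup (f := Int.natAbs) (Finsupp.mem_support_iff.2 h)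
  have h2 := Finset.le_sup (f := fun e => (MvPowerSeries.coeff e (fGen R K)).coeff.support.sup
    Int.natAbs) (Finset.mem_Iic.2 he)
  have h3 := h1.trans h2
  have h4 := Int.natCast_natAbs n
  lia

variable {R K}

theorem eval₂_eq_sum {S : Type*} [CommRing S] (φ : R →+* S) (x : Sˣ) (p : R[T;T⁻¹]) :
    eval₂ φ x p = p.coeff.sum fun n r => φ r * (x ^ n : Sˣ).val := by
  induction p using LaurentPolynomial.induction_on' with
  | add p q hp hq =>
    rw [map_add, hp, hq, AddMonoidAlgebra.coeff_add, Finsupp.sum_add_index']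
    · simp
    · intros
      rw [map_add, add_mul]
  | C_mul_T n a =>
    rw [eval₂_C_mul_T, ← single_eq_C_mul_T, AddMonoidAlgebra.coeff_single,
      Finsupp.sum_single_index (by simp)]

theorem map_fGen_eval₂ (x : Rˣ) :
    MvPowerSeries.map (eval₂ (RingHom.id R) x) (fGen R K) =
      ∏ j, MvPowerSeries.invOfUnit ((1 - MvPowerSeries.C (x : R) * MvPowerSeries.X j) *
        (1 - MvPowerSeries.C (x⁻¹ : Rˣ).val * MvPowerSeries.X j)) 1 := by
  rw [fGen, map_prod]
  refine Finset.prod_congr rfl fun j _ => ?_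
  rw [map_invOfUnit_one _ (by simp)]
  congr 1
  simp [eval₂_T]

variable {A : Type*} [CommRing A] {l : ℕ}

theorem map_SPstar (π : MvPowerSeries (Fin K) R →+* A) {F : A[T;T⁻¹]}
    (hF : ∀ n, F.coeff n = π (f R K n)) (al be : GenPartition l) :
    π (SPstar R K al be) =
      Matrix.det (Matrix.of fun i j => dualKernel F 1 (-1) 1 (be.seq i) (al.seq j)) := by
  rw [SPstar, RingHom.map_det]
  congr 1
  ext i j
  simp only [RingHom.mapMatrix_apply, Matrix.map_apply, Matrix.of_apply, map_sub, dualKernel, hF,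
    Pi.one_apply, GenPartition.seq_cast]
  rw [one_mul, neg_one_mul, ← sub_eq_add_neg]
  congr 3 <;> (push_cast; ring)

theorem GenPartition.seq_eq_zero_iff (be : GenPartition l) (i : Fin l) :
    be.seq i = 0 ↔ pos i = l ∧ be.part i = 0 := by
  have := i.isLt
  rw [GenPartition.seq, pos]
  lia

/-- A strictly decreasing sequence has at most one zero, so row factors `c` multiply to the single
normalizing constant of `Ostar`. -/
theorem prod_seq_eq (be : GenPartition l) {c : ℕ → A} (hc : ∀ t, t ≠ 0 → c t = 1)
    [Decidable (∃ i : Fin l, pos i = l ∧ be.part i = 0)] :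
    ∏ i, c (be.seq i) = if ∃ i : Fin l, pos i = l ∧ be.part i = 0 then c 0 else 1 := by
  split_ifs with h
  · obtain ⟨i, hi⟩ := h
    rw [← be.seq_eq_zero_iff] at hi
    rw [Finset.prod_eq_single i, hi]
    · intro j _ hj
      refine hc _ fun h0 => hj (be.seq_strictAnti.injective (h0.trans hi.symm))
    · simp
  · refine Finset.prod_eq_one fun i _ => hc _ fun h0 => h ⟨i, (be.seq_eq_zero_iff i).1 h0⟩

theorem map_Ostar [Algebra ℚ R] (π : MvPowerSeries (Fin K) R →+* A) {F : A[T;T⁻¹]}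
    (hF : ∀ n, F.coeff n = π (f R K n)) {c : ℕ → A}
    (hc0 : c 0 = π ((1 / 2 : ℚ) • 1)) (hc : ∀ t, t ≠ 0 → c t = 1) (al be : GenPartition l) :
    π (Ostar R K al be) =
      Matrix.det (Matrix.of fun i j => dualKernel F 0 1 c (be.seq i) (al.seq j)) := by
  have h1 : (Matrix.of fun i j => dualKernel F 0 1 c (be.seq i) (al.seq j)) =
      Matrix.of fun i j => c (be.seq i) * (Matrix.of fun i j : Fin l =>
        π (f R K (be.part i - al.part j - pos i + pos j)
        + f R K (be.part i + al.part j - pos i - pos j + 2 * l))) i j := by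
    ext i j
    simp only [Matrix.of_apply, dualKernel, hF, map_add, one_mul, GenPartition.seq_cast]
    congr 4 <;> (push_cast; ring)
  rw [h1, Matrix.det_mul_column, prod_seq_eq be hc, Ostar, ← smul_one_mul, map_mul,
    RingHom.map_det, hc0]
  congr 1
  split_ifs <;> simp

end DualSeries

/-! ### Assembly of the two identities. -/

section Main

open LaurentPolynomial

variable {R : Type*} [CommRing R] {l N K : ℕ}

theorem finite_of_forall_notMem {n : ℕ} {g : GenPartition n → R} (B : ℕ)
    (hg : ∀ ρ ∉ boundedPartitions n B, g ρ = 0) : {ρ | g ρ ≠ 0}.Finite :=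
  (boundedPartitions n B).finite_toSet.subset fun ρ hρ => by
    by_contra h
    exact hρ (hg ρ h)

theorem sp_eq_zero_of_notMem (x : Fin N → Rˣ) (lam : GenPartition (l + N)) {B : ℕ}
    (hB : ∀ i, lam.seq i < B) {tau : GenPartition l} (h : tau ∉ boundedPartitions l B) :
    sp x lam tau = 0 := by
  obtain ⟨j, hj⟩ := exists_le_of_notMem_boundedPartitions h
  rw [sp_eq_skewDet]
  exact skewDet_eq_zero x _ _ fun i => (hB i).trans_le hj

theorem o_eq_zero_of_notMem (x : Fin N → Rˣ) (lam : GenPartition (l + N)) {B : ℕ}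
    (hB : ∀ i, lam.seq i < B) {tau : GenPartition l} (h : tau ∉ boundedPartitions l B) :
    o x lam tau = 0 := by
  obtain ⟨j, hj⟩ := exists_le_of_notMem_boundedPartitions h
  rw [o_eq_skewDet]
  exact skewDet_eq_zero x _ _ fun i => (hB i).trans_le hj

/-- This makes the sum over `ρ` finite in each quotient. -/
theorem det_dualKernel_eq_zero {A : Type*} [CommRing A] {n : ℕ} {F : A[T;T⁻¹]} {a : ℕ} {ε : A}
    {c : ℕ → A} {B : ℕ} {L q : Fin n → ℕ} (hB : ∀ i, ∀ k : ℤ, (B : ℤ) ≤ |k| + L i → F.coeff k = 0)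
    {j : Fin n} (hj : B ≤ q j) :
    Matrix.det (Matrix.of fun i j => dualKernel F a ε c (L i) (q j)) = 0 := by
  refine Matrix.det_eq_zero_of_column_eq_zero j fun i => ?_
  have h1 := neg_abs_le ((L i : ℤ) - q j)
  have h2 := le_abs_self ((L i : ℤ) + q j + 2 * a)
  rw [Matrix.of_apply, dualKernel, hB i _ (by lia), hB i _ (by lia)]
  ring

theorem exists_laurent_of_quotient (d : Fin K →₀ ℕ) :
    ∃ (F : (MvPowerSeries (Fin K) R ⧸ coeffIdeal R d)[T;T⁻¹]) (B : ℕ),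
      (∀ n, F.coeff n = Ideal.Quotient.mk (coeffIdeal R d) (f R K n)) ∧
      (∀ n, F.coeff (-n) = F.coeff n) ∧ (∀ n : ℤ, (B : ℤ) ≤ |n| → F.coeff n = 0) ∧
      ∀ x : Rˣ, eval₂ (RingHom.id _)
        (Units.map ((Ideal.Quotient.mk (coeffIdeal R d)).comp MvPowerSeries.C) x) F =
        Ideal.Quotient.mk (coeffIdeal R d)
          (∏ j, MvPowerSeries.invOfUnit ((1 - MvPowerSeries.C (x : R) * MvPowerSeries.X j) *
            (1 - MvPowerSeries.C (x⁻¹ : Rˣ).val * MvPowerSeries.X j)) 1) := by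
  classical
  obtain ⟨B, hB⟩ := exists_f_mem_coeffIdeal R K d
  let π := Ideal.Quotient.mk (coeffIdeal (σ := Fin K) R d)
  let s : Finset ℤ := Finset.Ioo (-B : ℤ) B
  have hs (n : ℤ) (hn : n ∉ s) : (B : ℤ) ≤ |n| := by
    by_contra h
    exact hn (Finset.mem_Ioo.2 (abs_lt.1 (not_le.1 h)))
  let F : (MvPowerSeries (Fin K) R ⧸ coeffIdeal R d)[T;T⁻¹] :=
    .ofCoeff (Finsupp.onFinset s (fun n => π (f R K n)) fun n hn => by
      by_contra h
      exact hn (Ideal.Quotient.eq_zero_iff_mem.2 (hB n (hs n h))))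
  have hF (n : ℤ) : F.coeff n = π (f R K n) := rfl
  refine ⟨F, B, hF, fun n => by rw [hF, hF, f_neg],
    fun n hn => Ideal.Quotient.eq_zero_iff_mem.2 (hB n hn), fun x => ?_⟩
  rw [← map_fGen_eval₂, eval₂_eq_sum,
    Finsupp.sum_of_support_subset (s := s) _ Finsupp.support_onFinset_subset _ (by simp)]
  have h1 (n : ℤ) : RingHom.id _ (F.coeff n) *
      ((Units.map (π.comp (MvPowerSeries.C (σ := Fin K))).toMonoidHom x ^ n : Units _) : _ ⧸ _) =
      π (f R K n * MvPowerSeries.C (x ^ n : Rˣ).val) := by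
    rw [← map_zpow, map_mul]
    rfl
  -- It remains to compare coefficients at each `e ≤ d`, where substituting `x` for `T` is a finite
  -- sum over `s`.
  refine (Finset.sum_congr rfl fun n _ => h1 n).trans ?_
  rw [← map_sum, Ideal.Quotient.eq]
  intro e he
  rw [map_sub, sub_eq_zero, map_sum, MvPowerSeries.coeff_map, eval₂_eq_sum]
  rw [Finsupp.sum_of_support_subset (s := s)]
  · refine Finset.sum_congr rfl fun n _ => ?_
    rw [MvPowerSeries.coeff_mul_C]
    rfl
  · intro n hn
    by_contra h
    exact Finsupp.mem_support_iff.1 hn (hB n (hs n h) e he)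
  · simp

theorem hasSum_symplectic [TopologicalSpace R] (x : Fin N → Rˣ) (mu : GenPartition l)
    (lam : GenPartition (l + N)) :
    HasSum (fun rho : GenPartition (l + N) => sp x rho mu • SPstar R K rho lam)
      (cauchyProd x K * ∑ᶠ tau : GenPartition l, sp x lam tau • SPstar R K mu tau) := by
  refine hasSum_of_quotient fun d => ?_
  obtain ⟨F, B₀, hF, hsym, hB₀, heval⟩ := exists_laurent_of_quotient (R := R) d
  set π := Ideal.Quotient.mk (coeffIdeal (σ := Fin K) R d)
  -- `B` exceeds `B₀` plus any entry of either sequence: the kernels vanish beyond it, and so does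
  -- `sp x lam tau` for `tau` outside `boundedPartitions l B`.
  let B := B₀ + (∑ i, lam.seq i + ∑ j, mu.seq j + 1)
  have hL (i) : lam.seq i ≤ ∑ i, lam.seq i :=
    Finset.single_le_sum (fun _ _ => Nat.zero_le _) (Finset.mem_univ i)
  have hm (i) : mu.seq i ≤ ∑ i, mu.seq i :=
    Finset.single_le_sum (fun _ _ => Nat.zero_le _) (Finset.mem_univ i)
  have hBL (i) (k : ℤ) (hk : (B : ℤ) ≤ |k| + lam.seq i) : F.coeff k = 0 :=
    hB₀ k (by have := hL i; lia)
  have hBm (i) (k : ℤ) (hk : (B : ℤ) ≤ |k| + mu.seq i) : F.coeff k = 0 :=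
    hB₀ k (by have := hm i; lia)
  let φ : R →+* _ := π.comp MvPowerSeries.C
  have hsmul (r : R) (p : MvPowerSeries (Fin K) R) : π (r • p) = φ r * π p := by
    rw [MvPowerSeries.smul_eq_C_mul, map_mul]
    rfl
  refine ⟨boundedPartitions (l + N) B, fun rho hrho => ?_, ?_⟩
  · obtain ⟨j, hj⟩ := exists_le_of_notMem_boundedPartitions hrho
    rw [hsmul, map_SPstar π hF, det_dualKernel_eq_zero hBL hj, mul_zero]
  · rw [finsum_eq_sum_of_support_subset (s := boundedPartitions l B)]
    · have h := skewDet_cauchy_symplectic (fun i => Units.map φ.toMonoidHom (x i)) hsym hBL hBm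
      rw [← sum_boundedPartitions B fun q => skewDet _ 1 _ q mu.seq * Matrix.det _,
        ← sum_boundedPartitions B fun q => skewDet _ 1 _ lam.seq q * Matrix.det _] at h
      simp only [← sp_eq_skewDet, ← map_SPstar π hF] at h
      rw [map_sum, map_mul, map_sum, cauchyProd, map_prod]
      simp only [hsmul, map_sp]
      refine h.trans ?_
      congr 1
      exact Finset.prod_congr rfl fun i _ => heval (x i)
    · intro tau htau
      by_contra h
      refine htau ?_
      simp only
      rw [sp_eq_zero_of_notMem x lam (fun i => ?_) h, zero_smul]
      have := hL i
      lia

theorem hasSum_orthogonal [Algebra ℚ R] [TopologicalSpace R] (x : Fin N → Rˣ)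
    (mu : GenPartition l) (lam : GenPartition (l + N)) :
    HasSum (fun rho : GenPartition (l + N) => o x rho mu • Ostar R K rho lam)
      (cauchyProd x K * ∑ᶠ tau : GenPartition l, o x lam tau • Ostar R K mu tau) := by
  refine hasSum_of_quotient fun d => ?_
  obtain ⟨F, B₀, hF, hsym, hB₀, heval⟩ := exists_laurent_of_quotient (R := R) d
  set π := Ideal.Quotient.mk (coeffIdeal (σ := Fin K) R d)
  let B := B₀ + (∑ i, lam.seq i + ∑ j, mu.seq j + 1)
  have hL (i) : lam.seq i ≤ ∑ i, lam.seq i :=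
    Finset.single_le_sum (fun _ _ => Nat.zero_le _) (Finset.mem_univ i)
  have hm (i) : mu.seq i ≤ ∑ i, mu.seq i :=
    Finset.single_le_sum (fun _ _ => Nat.zero_le _) (Finset.mem_univ i)
  have hBL (i) (k : ℤ) (hk : (B : ℤ) ≤ |k| + lam.seq i) : F.coeff k = 0 :=
    hB₀ k (by have := hL i; lia)
  have hBm (i) (k : ℤ) (hk : (B : ℤ) ≤ |k| + mu.seq i) : F.coeff k = 0 :=
    hB₀ k (by have := hm i; lia)
  let φ : R →+* _ := π.comp MvPowerSeries.C
  have hsmul (r : R) (p : MvPowerSeries (Fin K) R) : π (r • p) = φ r * π p := by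
    rw [MvPowerSeries.smul_eq_C_mul, map_mul]
    rfl
  let c (t : ℕ) : MvPowerSeries (Fin K) R ⧸ coeffIdeal R d :=
    if t = 0 then π ((1 / 2 : ℚ) • 1) else 1
  have hc0 : 2 * c 0 = 1 := by
    have : (2 : MvPowerSeries (Fin K) R) * ((1 / 2 : ℚ) • 1) = 1 := by
      rw [two_mul, ← add_smul]
      norm_num
    simp only [c, if_true]
    rw [← map_ofNat π 2, ← map_mul, this, map_one]
  have hc (t : ℕ) (ht : t ≠ 0) : c t = 1 := if_neg ht
  have hO {n : ℕ} := map_Ostar (l := n) π hF (c := c) rfl hc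
  refine ⟨boundedPartitions (l + N) B, fun rho hrho => ?_, ?_⟩
  · obtain ⟨j, hj⟩ := exists_le_of_notMem_boundedPartitions hrho
    rw [hsmul, hO, det_dualKernel_eq_zero hBL hj, mul_zero]
  · rw [finsum_eq_sum_of_support_subset (s := boundedPartitions l B)]
    · have h := skewDet_cauchy_orthogonal (fun i => Units.map φ.toMonoidHom (x i)) hsym hc0 hc
        hBL hBm
      rw [← sum_boundedPartitions B fun q => skewDet _ 0 _ q mu.seq * Matrix.det _,
        ← sum_boundedPartitions B fun q => skewDet _ 0 _ lam.seq q * Matrix.det _] at h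
      simp only [← o_eq_skewDet, ← hO] at h
      rw [map_sum, map_mul, map_sum, cauchyProd, map_prod]
      simp only [hsmul, map_o]
      refine h.trans ?_
      congr 1
      exact Finset.prod_congr rfl fun i _ => heval (x i)
    · intro tau htau
      by_contra h
      refine htau ?_
      simp only
      rw [o_eq_zero_of_notMem x lam (fun i => ?_) h, zero_smul]
      have := hL i
      lia

end Main

end SkewCauchy

theorem mainTheorem4 {R : Type*} [CommRing R] [Algebra ℚ R]
    [TopologicalSpace R] [DiscreteTopology R]
    {l N K : ℕ} (x : Fin N → Rˣ)
    (mu : SkewCauchy.GenPartition l) (lam : SkewCauchy.GenPartition (l + N)) :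
    ({tau : SkewCauchy.GenPartition l | SkewCauchy.sp x lam tau ≠ 0}.Finite ∧
      HasSum
        (fun rho : SkewCauchy.GenPartition (l + N) =>
          SkewCauchy.sp x rho mu • SkewCauchy.SPstar R K rho lam)
        (SkewCauchy.cauchyProd x K *
          ∑ᶠ tau : SkewCauchy.GenPartition l,
            SkewCauchy.sp x lam tau • SkewCauchy.SPstar R K mu tau)) ∧
    ({tau : SkewCauchy.GenPartition l | SkewCauchy.o x lam tau ≠ 0}.Finite ∧
      HasSum
        (fun rho : SkewCauchy.GenPartition (l + N) =>
          SkewCauchy.o x rho mu • SkewCauchy.Ostar R K rho lam)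
        (SkewCauchy.cauchyProd x K *
          ∑ᶠ tau : SkewCauchy.GenPartition l,
            SkewCauchy.o x lam tau • SkewCauchy.Ostar R K mu tau)) := by
  have hL (i) : lam.seq i < ∑ i, lam.seq i + 1 :=
    Nat.lt_succ_of_le (Finset.single_le_sum (fun _ _ => Nat.zero_le _) (Finset.mem_univ i))
  exact ⟨⟨SkewCauchy.finite_of_forall_notMem _ fun _ =>
      SkewCauchy.sp_eq_zero_of_notMem x lam hL, SkewCauchy.hasSum_symplectic x mu lam⟩,
    ⟨SkewCauchy.finite_of_forall_notMem _ fun _ =>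
      SkewCauchy.o_eq_zero_of_notMem x lam hL, SkewCauchy.hasSum_orthogonal x mu lam⟩⟩
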